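/- Let $n \ge 0$ and $R_n = \mathbb{Q}[x_1,\dots,x_n]$. A noncrossing partition of size $n$ is a set $\lambda$ of arcs $(i,j)$ with $1 \le i < j \le n$ containing no two distinct arcs $(i,k)$, $(j,l)$ with $i \le j < k \le l$; it is regarded as a graph on the vertices $1,\dots,n$. Let $Q_\lambda$ be the permutation of $\{1,\dots,n\}$ with $Q_\lambda(j) = i$ if $(i,j) \in \lambda$ for some $i$, and with $Q_\lambda(j)$ the largest vertex in the connected component of $j$ if there is no such $i$. Let $\mathrm{QSV}_n$ be the set of all permutations $Q_\lambda$. A permutation $\sigma$ is identified with the point $(\sigma(1),\dots,\sigma(n)) \in \mathbb{Q}^n$, and $\mathbf{I}(\mathrm{QSV}_n) \subseteq R_n$ denotes the ideal of all polynomials vanishing on $\mathrm{QSV}_n \subset \mathbb{Q}^n$. For a composition $\alpha = (\alpha_1,\dots,\alpha_k)$ (a finite sequence of positive integers) put $$P_\alpha = \sum_{1 = f_1 < f_2 < \cdots < f_{\ell+1} = k+1}\ \ \sum_{1 \le i_1 < \cdots < i_\ell \le n}\ \ \prod_{j=1}^{\ell}\Big( \big(x_{i_j}^{\alpha_{f_j}}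 - i_j^{\alpha_{f_j}}\big) \prod_{s = f_j+1}^{f_{j+1}-1} \big(-\,i_j^{\alpha_s}\big)\Big) \in R_n,$$ where the first sum is over all $\ell$ and all such sequences $(f_1,\dots,f_{\ell+1})$ (equivalently, over all compositions $\beta$ that $\alpha$ refines, with $\beta_j = \alpha_{f_j} + \cdots + \alpha_{f_{j+1}-1}$). A polynomial $f \in R_n$ is quasisymmetric if for all positive integers $a_1,\dots,a_k$ the coefficient of $x_{i_1}^{a_1}\cdots x_{i_k}^{a_k}$ in $f$ is the same for all $1 \le i_1 < \cdots < i_k \le n$. Let $\mathrm{QSym}_n^+$ be the space of quasisymmetric polynomials with zero constant term. For $f \in R_n$ let $\mathsf{h}(f)$ be its homogeneous component of top degree, and for an ideal $I \subseteq R_n$ let $\mathsf{gr}(I) = \langle \mathsf{h}(f) \mid f \in I\rangle$. Then $$\langle P_\alpha \mid \alpha \text{ a nonempty composition with at most } n \text{ parts}\rangle = \mathbf{I}(\mathrm{QSV}_n) \qquad\text{and}\qquad \langle \mathrm{QSym}_n^+ \rangle = \mathsf{gr}\big(\mathbf{I}(\mathrm{QSV}_n)\big).$$ -/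

import Mathlib

noncomputable section

/-- A noncrossing partition of size `n`, as a diagram of arcs `(i, j)`, `i < j`, on the vertices
`1, …, n` (the vertex `v` is `v - 1 : Fin n`), such that there are no two different arcs
`(i, k)`, `(j, l)` with `i ≤ j < k ≤ l`. -/
structure NoncrossingPartition (n : ℕ) where
  arcs : Finset (Fin n × Fin n)
  lt_of_mem : ∀ p ∈ arcs, p.1 < p.2
  noncrossing : ∀ p ∈ arcs, ∀ q ∈ arcs, p ≠ q → ¬ (p.1 ≤ q.1 ∧ q.1 < p.2 ∧ p.2 ≤ q.2)

namespace NoncrossingPartition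

variable {n : ℕ} (L : NoncrossingPartition n)

/-- The underlying undirected graph of the diagram. -/
def graph : SimpleGraph (Fin n) where
  Adj i j := (i, j) ∈ L.arcs ∨ (j, i) ∈ L.arcs
  symm := ⟨fun _ _ h => h.symm⟩
  loopless := ⟨fun i h => by
    rcases h with h | h <;> exact absurd (L.lt_of_mem _ h) (lt_irrefl i)⟩

open Classical in
/-- The set of vertices connected to `j`. -/
def component (j : Fin n) : Finset (Fin n) :=
  Finset.univ.filter fun k => L.graph.Reachable j k

theorem mem_component {j k : Fin n} : k ∈ L.component j ↔ L.graph.Reachable j k := by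
  simp [component]

theorem self_mem_component (j : Fin n) : j ∈ L.component j := by
  simp [component]

open Classical in
/-- The map `Q_λ`: it sends `j` to its leftward neighbour if `j` is a right endpoint, and to the
largest vertex connected to `j` otherwise. -/
def qFun (j : Fin n) : Fin n :=
  if h : ∃ i, (i, j) ∈ L.arcs then h.choose
  else (L.component j).max' ⟨j, L.self_mem_component j⟩

theorem eq_of_left {i j k : Fin n} (h1 : (i, j) ∈ L.arcs) (h2 : (i, k) ∈ L.arcs) : j = k := by
  by_contra hne
  rcases lt_or_gt_of_ne hne with h | h
  · exact L.noncrossing _ h1 _ h2 (by simpa using hne) ⟨le_rfl, L.lt_of_mem _ h1, h.le⟩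
  · exact L.noncrossing _ h2 _ h1 (by simpa using Ne.symm hne) ⟨le_rfl, L.lt_of_mem _ h2, h.le⟩

theorem eq_of_right {i j k : Fin n} (h1 : (i, k) ∈ L.arcs) (h2 : (j, k) ∈ L.arcs) : i = j := by
  by_contra hne
  rcases lt_or_gt_of_ne hne with h | h
  · exact L.noncrossing _ h1 _ h2 (by simpa using hne) ⟨h.le, L.lt_of_mem _ h2, le_rfl⟩
  · exact L.noncrossing _ h2 _ h1 (by simpa using Ne.symm hne) ⟨h.le, L.lt_of_mem _ h1, le_rfl⟩

theorem qFun_of_mem {i j : Fin n} (h : (i, j) ∈ L.arcs) : L.qFun j = i := by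
  have hex : ∃ i, (i, j) ∈ L.arcs := ⟨i, h⟩
  unfold qFun
  rw [dif_pos hex]
  exact L.eq_of_right hex.choose_spec h

theorem qFun_of_not_mem {j : Fin n} (h : ∀ i, (i, j) ∉ L.arcs) :
    L.graph.Reachable j (L.qFun j) ∧ ∀ k, L.graph.Reachable j k → k ≤ L.qFun j := by
  have hex : ¬ ∃ i, (i, j) ∈ L.arcs := fun ⟨i, hi⟩ => h i hi
  unfold qFun
  rw [dif_neg hex]
  constructor
  · have := (L.component j).max'_mem ⟨j, L.self_mem_component j⟩
    exact L.mem_component.mp this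
  · intro k hk
    exact Finset.le_max' _ _ (L.mem_component.mpr hk)

theorem le_of_reachable {x y : Fin n} (hx : ∀ i, (i, x) ∉ L.arcs)
    (h : L.graph.Reachable x y) : x ≤ y := by
  have key : Relation.ReflTransGen (fun a b => (a, b) ∈ L.arcs) x y := by
    rw [SimpleGraph.reachable_iff_reflTransGen] at h
    induction h with
    | refl => exact .refl
    | tail _ hbc ih =>
      rcases hbc with hbc | hcb
      · exact ih.tail hbc
      · rcases ih.cases_tail with rfl | ⟨d, hd, hdb⟩
        · exact absurd hcb (hx _)
        · rwa [L.eq_of_right hcb hdb]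
  clear h
  induction key with
  | refl => exact le_rfl
  | tail _ hbc ih => exact ih.trans (L.lt_of_mem _ hbc).le

theorem qFun_injective : Function.Injective L.qFun := by
  have mixed : ∀ i j j' : Fin n, (i, j) ∈ L.arcs → (∀ k, (k, j') ∉ L.arcs) →
      L.qFun j = L.qFun j' → False := by
    intro i j j' hi hj' h
    rw [L.qFun_of_mem hi] at h
    obtain ⟨h1, h2⟩ := L.qFun_of_not_mem hj'
    rw [← h] at h1 h2
    have hadj : L.graph.Adj i j := Or.inl hi
    exact absurd (h2 j (h1.trans hadj.reachable)) (not_le.mpr (L.lt_of_mem _ hi))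
  intro j j' h
  by_cases hj : ∃ i, (i, j) ∈ L.arcs <;> by_cases hj' : ∃ i, (i, j') ∈ L.arcs
  · obtain ⟨i, hi⟩ := hj
    obtain ⟨i', hi'⟩ := hj'
    rw [L.qFun_of_mem hi, L.qFun_of_mem hi'] at h
    subst h
    exact L.eq_of_left hi hi'
  · obtain ⟨i, hi⟩ := hj
    exact (mixed i j j' hi (fun k hk => hj' ⟨k, hk⟩) h).elim
  · obtain ⟨i, hi⟩ := hj'
    exact (mixed i j' j hi (fun k hk => hj ⟨k, hk⟩) h.symm).elim
  · have a1 : ∀ k, (k, j) ∉ L.arcs := fun k hk => hj ⟨k, hk⟩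
    have a2 : ∀ k, (k, j') ∉ L.arcs := fun k hk => hj' ⟨k, hk⟩
    have r1 := (L.qFun_of_not_mem a1).1
    have r2 := (L.qFun_of_not_mem a2).1
    rw [← h] at r2
    have r : L.graph.Reachable j j' := r1.trans r2.symm
    exact le_antisymm (L.le_of_reachable a1 r) (L.le_of_reachable a2 r.symm)

/-- The permutation `Q_λ`. -/
def qPerm : Equiv.Perm (Fin n) :=
  Equiv.ofBijective L.qFun (Finite.injective_iff_bijective.mp L.qFun_injective)

end NoncrossingPartition

/-- The set of permutations `QSV_n = {Q_λ}`, `λ` a noncrossing partition of size `n`. -/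
def QSV (n : ℕ) : Set (Equiv.Perm (Fin n)) :=
  Set.range (NoncrossingPartition.qPerm (n := n))

/-- The point `(σ_1, …, σ_n) ∈ ℚⁿ` of a permutation `σ` of `1, …, n`; the entry that `Fin n`
numbers as `v` is the integer `v + 1`. -/
def permPoint {n : ℕ} (σ : Equiv.Perm (Fin n)) : Fin n → ℚ :=
  fun j => ((σ j : ℕ) : ℚ) + 1

/-- `QSV_n` as a set of points of `ℚⁿ`. -/
def QSVPoints (n : ℕ) : Set (Fin n → ℚ) := permPoint '' QSV n

open Classical in
/-- The polynomial
`P_α = ∑_{β ⪰ α} ∑_{i_1 < ⋯ < i_ℓ} ∏_j ((x_{i_j} ^ α_{f_j} - i_j ^ α_{f_j}) ∏_{f_j < s < f_{j+1}} (-(i_j ^ α_s)))`.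
The compositions `β` refined by `α` are the compositions `α.gather c`, one for each way `c` of
cutting the sequence of the parts of `α` into `ℓ = c.length` nonempty consecutive blocks; the
`j`-th block consists of the parts numbered `f_j, …, f_{j+1} - 1`, which are the values of
`c.embedding j`, with `f_j` its value at `0`. -/
def vanishingPoly (n : ℕ) {d : ℕ} (α : Composition d) : MvPolynomial (Fin n) ℚ :=
  ∑ c : Composition α.length,
    ∑ i ∈ Finset.univ.filter (fun i : Fin c.length → Fin n => StrictMono i),
      ∏ j : Fin c.length,
        ((MvPolynomial.X (i j) ^ α.blocksFun (c.embedding j ⟨0, c.one_le_blocksFun j⟩)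
            - MvPolynomial.C
              ((((i j : ℕ) : ℚ) + 1) ^ α.blocksFun (c.embedding j ⟨0, c.one_le_blocksFun j⟩)))
          * ∏ s ∈ Finset.univ.filter (fun s : Fin (c.blocksFun j) => 0 < (s : ℕ)),
              MvPolynomial.C (-((((i j : ℕ) : ℚ) + 1) ^ α.blocksFun (c.embedding j s))))

/-- A polynomial is quasisymmetric if, for all positive exponents `a_1, …, a_k`, the coefficient
of `x_{i_1}^{a_1} ⋯ x_{i_k}^{a_k}` is the same for all `i_1 < ⋯ < i_k`. -/
def IsQuasisymmetric {n : ℕ} (f : MvPolynomial (Fin n) ℚ) : Prop :=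
  ∀ (k : ℕ) (a : Fin k → ℕ), (∀ t, 0 < a t) →
    ∀ i j : Fin k → Fin n, StrictMono i → StrictMono j →
      f.coeff (∑ t, Finsupp.single (i t) (a t)) = f.coeff (∑ t, Finsupp.single (j t) (a t))

/-- The space `QSym_n^+`: quasisymmetric polynomials all of whose terms have positive degree,
i.e. with zero constant term. -/
def QSymPos (n : ℕ) : Set (MvPolynomial (Fin n) ℚ) :=
  {f | IsQuasisymmetric f ∧ MvPolynomial.constantCoeff f = 0}

/-- The top-degree homogeneous component `h(f)`. -/
def topComponent {n : ℕ} (f : MvPolynomial (Fin n) ℚ) : MvPolynomial (Fin n) ℚ :=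
  MvPolynomial.homogeneousComponent f.totalDegree f

/-- The ideal `gr(I)` generated by the top-degree components of the elements of `I`. -/
def topDegreeIdeal {n : ℕ} (I : Ideal (MvPolynomial (Fin n) ℚ)) :
    Ideal (MvPolynomial (Fin n) ℚ) :=
  Ideal.span (topComponent '' (I : Set (MvPolynomial (Fin n) ℚ)))

end

/-!
Let `y_a`, for `a ≥ 1`, be noncommuting variables. The polynomial `P_α` is the coefficient of the
word `y_{α_1} ⋯ y_{α_k}` in the ordered product over `v = 1, …, n` of
`(1 + ∑ x_v ^ a y_a) (1 + ∑ v ^ a y_a)⁻¹`. At the point `Q_λ` the factor of `v` becomes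
`g_{Q_λ(v)} g_v⁻¹` with `g_v = 1 + ∑ v ^ a y_a`; since `λ` is noncrossing, the product telescopes
to `1` in every group, so that the `P_α` vanish on `QSV_n`.

The part of `P_α` of degree `|α|` is the monomial quasisymmetric polynomial `M_α`, and the `M_α`
span `QSym_n^+`. Modulo the ideal of the `M_α` every monomial is a combination of the monomials
whose exponents stay below the diagonal: if `x^e` is not of this kind, the recursion of the
fundamental quasisymmetric polynomials in the first variable expresses it by lexicographically
smaller monomials. By induction on the degree the same monomials span modulo the ideal of the
`P_α`.

The exponents below the diagonal inject into the noncrossing partitions, through the heights of the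
associated lattice paths, and hence into `QSV_n`. Since the evaluation of polynomials at the finite
set `QSV_n` is surjective, counting dimensions shows that these monomials are independent modulo
the ideal of `QSV_n`, which forces both equalities.
-/

noncomputable section

open MvPolynomial

/-! ### Word series and noncommutative products -/

/-- Formal power series over `R` in noncommuting variables indexed by `β`, encoded as the
functions that send a word to its coefficient. -/
abbrev WordSeries (β R : Type*) := List β → R

namespace WordSeries

variable {β R S : Type*} [CommRing R] [CommRing S]

/-- The series `1`. -/
def one : WordSeries β R
  | [] => 1
  | _ :: _ => 0

/-- The product of the series `1 + ∑ a, u a • a` with `f`. -/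
def oneAddMul (u : β → R) (f : WordSeries β R) : WordSeries β R
  | [] => f []
  | a :: w => f (a :: w) + u a * f w

/-- The product of the inverse of the series `1 + ∑ a, u a • a` with `f`. -/
def oneAddInvMul (u : β → R) (f : WordSeries β R) : WordSeries β R
  | [] => f []
  | a :: w => f (a :: w) - u a * oneAddInvMul u f w

/-- Multiplication by `1 + ∑ a, u a • a` as a permutation of the series. -/
def oneAddPerm (u : β → R) : Equiv.Perm (WordSeries β R) where
  toFun := oneAddMul u
  invFun := oneAddInvMul u
  left_inv f := by
    funext w
    induction w with
    | nil => rfl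
    | cons a w ih => simp only [oneAddInvMul, oneAddMul, ih, add_sub_cancel_right]
  right_inv f := by
    funext w
    cases w <;> simp only [oneAddInvMul, oneAddMul, sub_add_cancel]

/-- The product of the series `1 + ∑ a, u a • a`, for `u` in a list. If the `u` are the functions
`a ↦ x ^ a` for a list of variables `x`, then its coefficients are the monomial quasisymmetric
functions in these variables. -/
def prodOneAdd (l : List (β → R)) : WordSeries β R := l.foldr oneAddMul one

/-- The product of the quotients `(1 + ∑ a, u a • a) (1 + ∑ a, v a • a)⁻¹`, for `(u, v)` in a
list. -/
def prodOneAddDiv (l : List ((β → R) × (β → R))) : WordSeries β R :=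
  l.foldr (fun p f => oneAddMul p.1 (oneAddInvMul p.2 f)) one

@[simp] theorem prodOneAdd_nil_apply (l : List (β → R)) : prodOneAdd l [] = 1 := by
  induction l with
  | nil => rfl
  | cons _ _ ih => exact ih

theorem prodOneAdd_cons_cons (u : β → R) (l : List (β → R)) (a : β) (w : List β) :
    prodOneAdd (u :: l) (a :: w) = prodOneAdd l (a :: w) + u a * prodOneAdd l w := rfl

theorem prodOneAdd_eq_zero (l : List (β → R)) (w : List β) (h : l.length < w.length) :
    prodOneAdd l w = 0 := by
  induction l generalizing w with
  | nil =>
    obtain ⟨a, w, rfl⟩ := List.exists_cons_of_length_pos (Nat.zero_lt_of_lt h)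
    rfl
  | cons u l ih =>
    cases w with
    | nil => exact absurd h (Nat.not_lt_zero _)
    | cons a w =>
      have hw : l.length < w.length := by simpa using h
      rw [prodOneAdd_cons_cons, ih (a :: w) (hw.trans (by simp)), ih w hw, mul_zero, add_zero]

theorem prodOneAddDiv_cons (p : (β → R) × (β → R)) (l : List ((β → R) × (β → R))) :
    prodOneAddDiv (p :: l) = oneAddMul p.1 (oneAddInvMul p.2 (prodOneAddDiv l)) := rfl

theorem prodOneAddDiv_eq_prod_oneAddPerm (l : List ((β → R) × (β → R))) :
    prodOneAddDiv l = (l.map fun p => oneAddPerm p.1 * (oneAddPerm p.2)⁻¹).prod one := by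
  induction l with
  | nil => rfl
  | cons p l ih =>
    rw [prodOneAddDiv_cons, ih, List.map_cons, List.prod_cons]
    rfl

theorem map_oneAddMul (φ : R →+* S) (u : β → R) (f : WordSeries β R) :
    φ ∘ oneAddMul u f = oneAddMul (φ ∘ u) (φ ∘ f) := by
  funext w
  cases w <;> simp [oneAddMul]

theorem map_oneAddInvMul (φ : R →+* S) (u : β → R) (f : WordSeries β R) :
    φ ∘ oneAddInvMul u f = oneAddInvMul (φ ∘ u) (φ ∘ f) := by
  funext w
  induction w with
  | nil => rfl
  | cons a w ih =>
    rw [Function.comp_apply] at ih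
    simp [oneAddInvMul, ih]

theorem map_prodOneAddDiv (φ : R →+* S) (l : List ((β → R) × (β → R))) :
    φ ∘ prodOneAddDiv l = prodOneAddDiv (l.map fun p => (φ ∘ p.1, φ ∘ p.2)) := by
  induction l with
  | nil =>
    funext w
    cases w <;> simp [prodOneAddDiv, one]
  | cons p l ih => rw [prodOneAddDiv_cons, map_oneAddMul, map_oneAddInvMul, ih]; rfl

end WordSeries

/-- All ways to cut a list into nonempty consecutive pieces. -/
def splits {β : Type*} : List β → List (List (List β))
  | [] => [[]]
  | a :: w => (splits w).map ([a] :: ·) ++ (splits w).flatMap fun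
      | [] => []
      | u :: L => [(a :: u) :: L]

theorem mem_splits {β : Type*} {w : List β} {L : List (List β)} :
    L ∈ splits w ↔ L.flatten = w ∧ [] ∉ L := by
  induction w generalizing L with
  | nil =>
    rcases L with _ | ⟨_ | ⟨b, u⟩, L⟩ <;> simp [splits]
  | cons a w ih =>
    have mem_cons : L ∈ splits (a :: w) ↔ (∃ L' ∈ splits w, [a] :: L' = L) ∨
        ∃ u L', u :: L' ∈ splits w ∧ L = (a :: u) :: L' := by
      simp only [splits, List.mem_append, List.mem_map, List.mem_flatMap]
      refine or_congr_right ⟨?_, fun ⟨u, L', h, e⟩ => ⟨_, h, by simpa using e⟩⟩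
      rintro ⟨_ | ⟨u, L'⟩, h, e⟩
      · exact absurd e List.not_mem_nil
      · exact ⟨u, L', h, by simpa using e⟩
    rw [mem_cons]
    simp only [ih]
    constructor
    · rintro (⟨L', ⟨rfl, h0⟩, rfl⟩ | ⟨u, L', ⟨rfl, h0⟩, rfl⟩) <;> simp_all
    · rintro ⟨h, h0⟩
      rcases L with _ | ⟨_ | ⟨b, _ | ⟨c, u⟩⟩, L⟩
      · simp at h
      · simp at h0
      · exact Or.inl ⟨L, by simp_all⟩
      · exact Or.inr ⟨c :: u, L, by simp_all⟩

theorem nodup_splits {β : Type*} (w : List β) : (splits w).Nodup := by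
  induction w with
  | nil => simp [splits]
  | cons a w ih =>
    rw [splits, List.nodup_append']
    refine ⟨ih.map fun L L' h => List.tail_eq_of_cons_eq h, ?_, ?_⟩
    · rw [List.nodup_flatMap]
      refine ⟨by rintro (_ | ⟨u, L⟩) - <;> simp, ih.imp ?_⟩
      rintro (_ | ⟨u, L⟩) (_ | ⟨u', L'⟩) hne <;> grind [List.Disjoint]
    · intro L h1 h2
      obtain ⟨L', -, rfl⟩ := List.mem_map.mp h1
      obtain ⟨_ | ⟨u, L''⟩, h3, h4⟩ := List.mem_flatMap.mp h2
      · simp at h4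
      · obtain rfl : u = [] := by simp_all
        exact (mem_splits.mp h3).2 List.mem_cons_self

theorem sum_composition_eq_sum_splits {β M : Type*} [AddCommMonoid M] (w : List β)
    (f : List (List β) → M) :
    ∑ c : Composition w.length, f (w.splitWrtComposition c) = ((splits w).map f).sum := by
  classical
  rw [← List.sum_toFinset f (nodup_splits w)]
  refine Finset.sum_bij (fun c _ => w.splitWrtComposition c) (fun c _ => ?_) (fun c _ c' _ h => ?_)
    (fun L hL => ?_) fun _ _ => rfl
  · rw [List.mem_toFinset, mem_splits]
    refine ⟨List.flatten_splitWrtComposition _ _, fun h => ?_⟩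
    simpa using List.length_pos_of_mem_splitWrtComposition h
  · ext1
    rw [← List.map_length_splitWrtComposition w c, ← List.map_length_splitWrtComposition w c', h]
  · rw [List.mem_toFinset, mem_splits] at hL
    obtain ⟨rfl, h0⟩ := hL
    refine ⟨⟨L.map List.length, fun hi => ?_, by simp [List.length_flatten]⟩, Finset.mem_univ _,
      List.splitWrtComposition_flatten _ _ rfl⟩
    obtain ⟨u, hu, rfl⟩ := List.mem_map.mp hi
    exact List.length_pos_of_ne_nil fun h => h0 (h ▸ hu)

theorem sum_splits_cons {β M : Type*} [AddCommMonoid M] (a : β) (w : List β)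
    (f : List (List β) → M) :
    ((splits (a :: w)).map f).sum = ((splits w).map fun L => f ([a] :: L) + match L with
      | [] => 0
      | u :: L => f ((a :: u) :: L)).sum := by
  rw [splits, List.map_append, List.sum_append, List.map_map, List.map_flatMap, List.flatMap_def,
    List.sum_flatten, List.map_map, List.sum_map_add]
  congr 2
  refine List.map_congr_left fun L _ => ?_
  cases L <;> simp

namespace WordSeries

variable {β R : Type*} [CommRing R]

/-- The series obtained from `F` by substituting for each variable `u : List β` the word `u`, the
empty words being left out so that the sums are finite. -/
def flattenSum (F : WordSeries (List β) R) : WordSeries β R :=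
  fun w => ((splits w).map F).sum

/-- The coefficient of `u` in `(1 + ∑ a, c a • a)⁻¹`. -/
def geometricWeight (c : β → R) (u : List β) : R := (u.map fun s => -c s).prod

/-- The coefficient of the nonempty word `u` in `(1 + ∑ a, x a • a) (1 + ∑ a, c a • a)⁻¹`. -/
def blockWeight (x c : β → R) : List β → R
  | [] => 0
  | a :: u => (x a - c a) * geometricWeight c u

theorem flattenSum_oneAddMul_cons {ω : List β → R} {c : β → R} {a : β} {k : R}
    (hω : ∀ u, ω (a :: u) = k * geometricWeight c u) (F : WordSeries (List β) R) (w : List β) :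
    flattenSum (oneAddMul ω F) (a :: w)
      = flattenSum F (a :: w) + k * flattenSum (oneAddMul (geometricWeight c) F) w := by
  simp only [flattenSum, sum_splits_cons]
  rw [← List.sum_map_mul_left, ← List.sum_map_add]
  congr 1
  refine List.map_congr_left fun L _ => ?_
  cases L with
  | nil => simp [oneAddMul, hω, geometricWeight]
  | cons u L =>
    simp only [oneAddMul, hω]
    simp only [geometricWeight, List.map_nil, List.prod_nil]
    ring

theorem flattenSum_oneAddMul_geometricWeight (c : β → R) (F : WordSeries (List β) R) :
    flattenSum (oneAddMul (geometricWeight c) F) = oneAddInvMul c (flattenSum F) := by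
  funext w
  induction w with
  | nil => simp [flattenSum, splits, oneAddMul, oneAddInvMul]
  | cons a w ih =>
    rw [flattenSum_oneAddMul_cons (k := -c a) (c := c) (fun u => by simp [geometricWeight]), ih,
      oneAddInvMul, neg_mul, sub_eq_add_neg]

theorem flattenSum_oneAddMul_blockWeight (x c : β → R) (F : WordSeries (List β) R) :
    flattenSum (oneAddMul (blockWeight x c) F)
      = oneAddMul x (oneAddInvMul c (flattenSum F)) := by
  funext w
  cases w with
  | nil => simp [flattenSum, splits, oneAddMul, oneAddInvMul]
  | cons a w =>
    rw [flattenSum_oneAddMul_cons fun u => rfl, flattenSum_oneAddMul_geometricWeight]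
    simp only [oneAddMul, oneAddInvMul]
    ring

theorem flattenSum_prodOneAdd_blockWeight (l : List ((β → R) × (β → R))) :
    flattenSum (prodOneAdd (l.map fun p => blockWeight p.1 p.2)) = prodOneAddDiv l := by
  induction l with
  | nil =>
    funext w
    cases w with
    | nil => simp [flattenSum, splits, prodOneAdd, prodOneAddDiv, one]
    | cons a w =>
      refine List.sum_eq_zero fun r hr => ?_
      obtain ⟨L, hL, rfl⟩ := List.mem_map.mp hr
      cases L with
      | nil => simp [mem_splits] at hL
      | cons u L => rfl
  | cons p l ih =>
    rw [prodOneAddDiv_cons, ← ih, ← flattenSum_oneAddMul_blockWeight]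
    rfl

end WordSeries

open Classical in
/-- The increasing sequences of length `k` in `Fin n`. -/
def increasingMaps (k n : ℕ) : Finset (Fin k → Fin n) := Finset.univ.filter StrictMono

theorem mem_increasingMaps {k n : ℕ} {i : Fin k → Fin n} :
    i ∈ increasingMaps k n ↔ StrictMono i := by
  simp [increasingMaps]

theorem strictMono_cons_zero_succ_comp {k n : ℕ} {i : Fin k → Fin n} (hi : StrictMono i) :
    StrictMono (Fin.cons 0 (Fin.succ ∘ i) : Fin (k + 1) → Fin (n + 1)) := by
  intro s t hst
  cases t using Fin.cases with
  | zero => exact absurd hst (Fin.not_lt_zero _)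
  | succ t =>
    cases s using Fin.cases with
    | zero => simp
    | succ s => simpa using hi (Fin.succ_lt_succ_iff.mp hst)

theorem exists_succ_comp_eq {k n : ℕ} {i : Fin k → Fin (n + 1)} (hi : StrictMono i)
    (h : ∀ t, i t ≠ 0) : ∃ j ∈ increasingMaps k n, Fin.succ ∘ j = i := by
  choose j hj using fun t => Fin.exists_succ_eq.mpr (h t)
  obtain rfl : Fin.succ ∘ j = i := funext hj
  exact ⟨j, mem_increasingMaps.mpr fun s t hst => Fin.succ_lt_succ_iff.mp (hi hst), rfl⟩

theorem sum_increasingMaps_succ {M : Type*} [AddCommMonoid M] {k n : ℕ}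
    (F : (Fin (k + 1) → Fin (n + 1)) → M) :
    ∑ i ∈ increasingMaps (k + 1) (n + 1), F i
      = ∑ i ∈ increasingMaps (k + 1) n, F (Fin.succ ∘ i)
        + ∑ i ∈ increasingMaps k n, F (Fin.cons 0 (Fin.succ ∘ i)) := by
  classical
  rw [← Finset.sum_filter_not_add_sum_filter _ (fun i => i 0 = 0)]
  congr 1 <;> symm
  · refine Finset.sum_bij (fun i _ => Fin.succ ∘ i) (fun i hi => ?_)
      (fun _ _ _ _ h => (Fin.succ_injective n).comp_left h) (fun i hi => ?_) fun _ _ => rfl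
    · simp only [Finset.mem_filter, mem_increasingMaps] at hi ⊢
      exact ⟨Fin.strictMono_succ.comp hi, Fin.succ_ne_zero _⟩
    · obtain ⟨hi, h0⟩ := Finset.mem_filter.mp hi
      rw [mem_increasingMaps] at hi
      simpa using exists_succ_comp_eq hi fun t =>
        ((Fin.pos_of_ne_zero h0).trans_le (hi.monotone (Fin.zero_le t))).ne'
  · refine Finset.sum_bij (fun i _ => Fin.cons 0 (Fin.succ ∘ i)) (fun i hi => ?_)
      (fun _ _ _ _ h => (Fin.succ_injective n).comp_left (Fin.cons_right_injective _ h))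
      (fun i hi => ?_) fun _ _ => rfl
    · rw [mem_increasingMaps] at hi
      simpa [mem_increasingMaps] using strictMono_cons_zero_succ_comp hi
    · obtain ⟨hi, h0⟩ := Finset.mem_filter.mp hi
      rw [mem_increasingMaps] at hi
      obtain ⟨j, hj, hji⟩ := exists_succ_comp_eq (hi.comp Fin.strictMono_succ) fun t =>
        ((Fin.zero_le _).trans_lt (hi (Fin.succ_pos t))).ne'
      exact ⟨j, hj, by rw [hji, ← h0]; exact Fin.cons_self_tail i⟩

theorem WordSeries.prodOneAdd_ofFn {β R : Type*} [CommRing R] {k n : ℕ} (u : Fin n → β → R)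
    (a : Fin k → β) :
    prodOneAdd (List.ofFn u) (List.ofFn a) = ∑ i ∈ increasingMaps k n, ∏ t, u (i t) (a t) := by
  induction n generalizing k with
  | zero =>
    cases k with
    | zero => simp [increasingMaps, Subsingleton.strictMono]
    | succ k => simp [increasingMaps, prodOneAdd, one]
  | succ n ih =>
    cases k with
    | zero => simp [increasingMaps, Subsingleton.strictMono]
    | succ k =>
      rw [List.ofFn_succ, List.ofFn_succ, prodOneAdd_cons_cons, ← List.ofFn_succ, ih, ih,
        sum_increasingMaps_succ, Finset.mul_sum]
      simp [Fin.prod_univ_succ]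

theorem splitWrtComposition_eq_ofFn {β : Type*} (l : List β) (c : Composition l.length) :
    l.splitWrtComposition c = List.ofFn fun j => List.ofFn fun s => l.get (c.embedding j s) := by
  refine List.ext_getElem (by simp) fun j h _ => ?_
  have hj : j < c.length := by simpa using h
  have hsucc := c.sizeUpTo_succ hj
  have hle := c.sizeUpTo_le (j + 1)
  rw [List.getElem_splitWrtComposition]
  refine List.ext_getElem ?_ fun s _ _ => ?_
  · simp [Composition.blocksFun]
    omega
  · simp

namespace WordSeries

theorem blockWeight_ofFn {β R : Type*} [CommRing R] (x c : β → R) {k : ℕ} (hk : 0 < k)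
    (a : Fin k → β) :
    blockWeight x c (List.ofFn a) = (x (a ⟨0, hk⟩) - c (a ⟨0, hk⟩))
      * ∏ s ∈ Finset.univ.filter (fun s : Fin k => 0 < (s : ℕ)), -c (a s) := by
  cases k with
  | zero => exact absurd hk (lt_irrefl 0)
  | succ k =>
    rw [List.ofFn_succ, blockWeight, Finset.prod_filter, Fin.prod_univ_succ]
    simp [geometricWeight, List.prod_ofFn]

end WordSeries

open WordSeries in
theorem vanishingPoly_eq_prodOneAddDiv (n : ℕ) {d : ℕ} (α : Composition d) :
    vanishingPoly n α = prodOneAddDiv (List.ofFn fun v : Fin n =>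
      (fun a => X v ^ a, fun a => C (((v : ℕ) : ℚ) + 1) ^ a)) α.blocks := by
  rw [← flattenSum_prodOneAdd_blockWeight, flattenSum, ← sum_composition_eq_sum_splits]
  refine Finset.sum_congr rfl fun c _ => ?_
  rw [splitWrtComposition_eq_ofFn, List.map_ofFn, prodOneAdd_ofFn]
  refine Finset.sum_congr rfl fun i _ => Finset.prod_congr rfl fun j _ => ?_
  rw [Function.comp_apply, blockWeight_ofFn _ _ (c.one_le_blocksFun j)]
  simp only [← map_pow, ← map_neg]
  rfl

/-! ### Vanishing on the points of noncrossing partitions -/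

namespace NoncrossingPartition

variable {n : ℕ} (L : NoncrossingPartition n)

/-- `y` is reached from `x` by following arcs to the right. -/
def Path : Fin n → Fin n → Prop := Relation.ReflTransGen fun x y => (x, y) ∈ L.arcs

variable {L}

theorem Path.le {x y : Fin n} (h : L.Path x y) : x ≤ y := by
  induction h with
  | refl => exact le_rfl
  | tail _ hbc ih => exact ih.trans (L.lt_of_mem _ hbc).le

theorem Path.reachable {x y : Fin n} (h : L.Path x y) : L.graph.Reachable x y := by
  rw [SimpleGraph.reachable_iff_reflTransGen]
  exact Relation.ReflTransGen.mono (fun _ _ => Or.inl) _ _ h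

theorem Path.exists_arc_of_not {x y : Fin n} {S : Fin n → Prop} (h : L.Path x y) (hx : S x)
    (hy : ¬ S y) : ∃ p q, (p, q) ∈ L.arcs ∧ L.Path x p ∧ S p ∧ ¬ S q := by
  induction h with
  | refl => exact absurd hx hy
  | @tail b c hb hbc ih =>
    by_cases hSb : S b
    · exact ⟨b, c, hbc, hb, hSb, hy⟩
    · exact ih hSb

theorem path_of_reachable {x y : Fin n} (hx : ∀ z, (x, z) ∉ L.arcs)
    (h : L.graph.Reachable x y) : L.Path y x := by
  rw [SimpleGraph.reachable_iff_reflTransGen] at h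
  induction h with
  | refl => exact .refl
  | tail _ hbc ih =>
    rcases hbc with hbc | hcb
    · rcases ih.cases_head with rfl | ⟨d, hbd, hd⟩
      · exact absurd hbc (hx _)
      · rwa [L.eq_of_left hbc hbd]
    · exact ih.head hcb

theorem exists_root_path (L : NoncrossingPartition n) (y : Fin n) :
    ∃ r, (∀ i, (i, r) ∉ L.arcs) ∧ L.Path r y := by
  induction y using WellFoundedLT.induction with
  | ind y ih =>
    by_cases hy : ∃ i, (i, y) ∈ L.arcs
    · obtain ⟨i, hi⟩ := hy
      obtain ⟨r, hr, hri⟩ := ih i (L.lt_of_mem _ hi)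
      exact ⟨r, hr, hri.tail hi⟩
    · exact ⟨y, not_exists.mp hy, .refl⟩

theorem qFun_eq_of_path {r m : Fin n} (hr : ∀ i, (i, r) ∉ L.arcs) (hm : ∀ j, (m, j) ∉ L.arcs)
    (h : L.Path r m) : L.qFun r = m := by
  obtain ⟨hQ, hmax⟩ := L.qFun_of_not_mem hr
  exact le_antisymm (path_of_reachable hm (h.reachable.symm.trans hQ)).le (hmax m h.reachable)

variable (L) in
/-- The interval `[a, k)` is a union of connected components. -/
def Saturated (a k : ℕ) : Prop :=
  ∀ x y : Fin n, (x, y) ∈ L.arcs → ((x : ℕ) ∈ Set.Ico a k ↔ (y : ℕ) ∈ Set.Ico a k)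

theorem Saturated.mem_iff_of_path {a k : ℕ} (h : L.Saturated a k) {x y : Fin n}
    (hxy : L.Path x y) : (x : ℕ) ∈ Set.Ico a k ↔ (y : ℕ) ∈ Set.Ico a k := by
  induction hxy with
  | refl => rfl
  | tail _ hbc ih => exact ih.trans (h _ _ hbc)

theorem saturated_of_arc {u v : Fin n} (h : (u, v) ∈ L.arcs) : L.Saturated (u + 1) v := by
  intro x y hxy
  have hlt := L.lt_of_mem _ hxy
  have hux := L.noncrossing _ h _ hxy
  have hxu := L.noncrossing _ hxy _ h
  simp only [Set.mem_Ico, Prod.mk.injEq, ne_eq] at *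
  omega

theorem Saturated.of_root {a : ℕ} {m r : Fin n} (h : L.Saturated a (m + 1))
    (hr : ∀ i, (i, r) ∉ L.arcs) (hrm : L.Path r m) : L.Saturated a r := by
  intro x y hxy
  have hlt := L.lt_of_mem _ hxy
  have hrm_le := hrm.le
  have hyr : y ≠ r := fun e => hr x (e ▸ hxy)
  have iff_succ := h x y hxy
  have not_straddle : ¬ (x < r ∧ r < y ∧ y ≤ m) := by
    rintro ⟨hxr, hry, hym⟩
    obtain ⟨p, q, hpq, hrp, hpy, hyq⟩ := hrm.exists_arc_of_not (S := (· < y)) hry hym.not_gt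
    have hxp : x < p := hxr.trans_le hrp.le
    exact L.noncrossing _ hxy _ hpq (fun e => hxp.ne (congrArg Prod.fst e))
      ⟨hxp.le, hpy, not_lt.mp hyq⟩
  simp only [Set.mem_Ico] at *
  omega

section prod

variable {G : Type*} [Group G] (g : Fin n → G)

variable (L) in
/-- The product of the factors `g (Q_λ v) * (g v)⁻¹` over the first `k` vertices `v`. -/
def partialProd (k : ℕ) : G := ((List.ofFn fun v => g (L.qFun v) * (g v)⁻¹).take k).prod

theorem partialProd_succ (v : Fin n) :
    L.partialProd g (v + 1) = L.partialProd g v * (g (L.qFun v) * (g v)⁻¹) := by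
  simp [partialProd, List.prod_take_succ]

theorem Path.partialProd_succ_eq {r m v : Fin n}
    (h : ∀ u v, (u, v) ∈ L.arcs → v ≤ m → L.partialProd g v = L.partialProd g (u + 1))
    (hv : L.Path r v) (hvm : v ≤ m) :
    L.partialProd g (v + 1) = L.partialProd g r * (g (L.qFun r) * (g v)⁻¹) := by
  induction hv with
  | refl => exact partialProd_succ g r
  | @tail u v _ huv ih =>
    rw [partialProd_succ, L.qFun_of_mem huv, h u v huv hvm,
      ih ((L.lt_of_mem _ huv).le.trans hvm)]
    group

theorem Saturated.partialProd_eq {a k : ℕ} (hk : k ≤ n) (hak : a ≤ k) (h : L.Saturated a k) :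
    L.partialProd g k = L.partialProd g a := by
  induction k using Nat.strong_induction_on generalizing a with
  | h k ih =>
    rcases hak.eq_or_lt with rfl | hak
    · rfl
    obtain ⟨m, rfl⟩ : ∃ m : Fin n, k = m + 1 := ⟨⟨k - 1, by omega⟩, by simp; omega⟩
    obtain ⟨r, hr, hrm⟩ := L.exists_root_path m
    have hm : ∀ j, (m, j) ∉ L.arcs := fun j hj => by
      have hlt : (m : ℕ) < j := L.lt_of_mem _ hj
      have hmem := (h m j hj).mp ⟨Nat.le_of_lt_succ hak, Nat.lt_succ_self _⟩
      exact absurd hmem.2 (by omega)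
    have har : a ≤ r :=
      ((h.mem_iff_of_path hrm).mpr ⟨Nat.le_of_lt_succ hak, Nat.lt_succ_self _⟩).1
    have inside_arc : ∀ u v, (u, v) ∈ L.arcs → v ≤ m →
        L.partialProd g v = L.partialProd g (u + 1) := fun u v huv hvm =>
      ih v (Nat.lt_succ_of_le hvm) v.2.le (L.lt_of_mem _ huv) (saturated_of_arc huv)
    rw [hrm.partialProd_succ_eq g inside_arc le_rfl, qFun_eq_of_path hr hm hrm, mul_inv_cancel,
      mul_one]
    exact ih r (Nat.lt_succ_of_le hrm.le) r.2.le har (h.of_root hr hrm)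

variable (L) in
theorem prod_qFun : (List.ofFn fun v => g (L.qFun v) * (g v)⁻¹).prod = 1 := by
  have saturated : L.Saturated 0 n := fun x y _ => by simp
  simpa [partialProd, List.take_of_length_le] using saturated.partialProd_eq g le_rfl n.zero_le

end prod

variable (L) in
theorem prodOneAddDiv_qFun {β R : Type*} [CommRing R] (u : Fin n → β → R) :
    WordSeries.prodOneAddDiv (List.ofFn fun v => (u (L.qFun v), u v)) = WordSeries.one := by
  rw [WordSeries.prodOneAddDiv_eq_prod_oneAddPerm, List.map_ofFn]
  exact congrArg (fun e : Equiv.Perm (WordSeries β R) => e WordSeries.one)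
    (L.prod_qFun fun v => WordSeries.oneAddPerm (u v))

end NoncrossingPartition

open WordSeries in
theorem vanishingPoly_mem_vanishingIdeal (n : ℕ) {d : ℕ} (α : Composition d) (hd : 0 < d) :
    vanishingPoly n α ∈ vanishingIdeal ℚ (QSVPoints n) := by
  rw [mem_vanishingIdeal_iff]
  rintro _ ⟨_, ⟨L, rfl⟩, rfl⟩
  obtain ⟨a, w, hα⟩ := List.exists_cons_of_ne_nil (mt α.blocks_eq_nil.mp hd.ne')
  let powers : Fin n → ℕ → ℚ := fun v a => (((v : ℕ) : ℚ) + 1) ^ a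
  let φ : MvPolynomial (Fin n) ℚ →ₐ[ℚ] ℚ := aeval (permPoint L.qPerm)
  let l : List ((ℕ → MvPolynomial (Fin n) ℚ) × (ℕ → MvPolynomial (Fin n) ℚ)) :=
    List.ofFn fun v => (fun a => X v ^ a, fun a => C (((v : ℕ) : ℚ) + 1) ^ a)
  have map_l : l.map (fun p => (⇑φ ∘ p.1, ⇑φ ∘ p.2))
      = List.ofFn fun v => (powers (L.qFun v), powers v) := by
    rw [List.map_ofFn]
    refine congrArg List.ofFn (funext fun v => ?_)
    ext a <;> simp [φ, powers, permPoint, NoncrossingPartition.qPerm]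
  calc φ (vanishingPoly n α)
    _ = φ (prodOneAddDiv l α.blocks) := by rw [vanishingPoly_eq_prodOneAddDiv]
    _ = prodOneAddDiv (l.map fun p => (⇑φ ∘ p.1, ⇑φ ∘ p.2)) α.blocks :=
      congrFun (map_prodOneAddDiv φ.toRingHom l) α.blocks
    _ = 0 := by rw [map_l, L.prodOneAddDiv_qFun, hα]; rfl

/-! ### Leading forms -/

section DegreeFiltration

variable {σ R : Type*} [CommRing R]

variable (σ R) in
/-- The polynomials all of whose terms have degree less than `d`. -/
def degreeLT (d : ℕ) : Submodule R (MvPolynomial σ R) :=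
  restrictSupport R {m | m.degree < d}

theorem mem_degreeLT {d : ℕ} {p : MvPolynomial σ R} :
    p ∈ degreeLT σ R d ↔ ∀ m ∈ p.support, m.degree < d := by
  rw [degreeLT, mem_restrictSupport_iff]
  exact Iff.rfl

theorem degreeLT_zero : degreeLT σ R 0 = ⊥ := by
  ext p
  simp [mem_degreeLT, ← support_eq_empty, Finset.eq_empty_iff_forall_notMem]

theorem degreeLT_mono {d e : ℕ} (h : d ≤ e) : degreeLT σ R d ≤ degreeLT σ R e :=
  restrictSupport_mono _ fun _ hm => lt_of_lt_of_le hm h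

theorem mem_degreeLT_totalDegree (p : MvPolynomial σ R) : p ∈ degreeLT σ R (p.totalDegree + 1) :=
  mem_degreeLT.mpr fun _ hm => Nat.lt_succ_of_le (le_totalDegree hm)

theorem mem_degreeLT_of_isHomogeneous {d : ℕ} {p : MvPolynomial σ R} (hp : p.IsHomogeneous d) :
    p ∈ degreeLT σ R (d + 1) := by
  refine degreeLT_mono ?_ (mem_degreeLT_totalDegree p)
  exact Nat.succ_le_succ hp.totalDegree_le

theorem mul_mem_degreeLT {d e : ℕ} {p q : MvPolynomial σ R} (hp : p.IsHomogeneous d)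
    (hq : q ∈ degreeLT σ R e) : p * q ∈ degreeLT σ R (d + e) := by
  classical
  rw [mem_degreeLT] at *
  intro m hm
  obtain ⟨a, ha, b, hb, rfl⟩ := Finset.mem_add.mp (support_mul p q hm)
  have had : a.degree = d := by
    rw [Finsupp.degree_eq_weight_one]
    exact hp (mem_support_iff.mp ha)
  rw [map_add, had]
  exact Nat.add_lt_add_left (hq b hb) d

theorem homogeneousComponent_eq_zero_of_mem_degreeLT {d : ℕ} {p : MvPolynomial σ R}
    (hp : p ∈ degreeLT σ R d) : homogeneousComponent d p = 0 :=
  homogeneousComponent_eq_zero' _ _ fun m hm => (mem_degreeLT.mp hp m hm).ne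

theorem sub_homogeneousComponent_mem_degreeLT {d : ℕ} {p : MvPolynomial σ R}
    (hp : p ∈ degreeLT σ R (d + 1)) : p - homogeneousComponent d p ∈ degreeLT σ R d := by
  rw [mem_degreeLT] at *
  intro m hm
  rw [mem_support_iff, coeff_sub, coeff_homogeneousComponent] at hm
  split_ifs at hm with h
  · exact absurd (sub_self _) hm
  · rw [sub_zero] at hm
    have := hp m (mem_support_iff.mpr hm)
    omega

end DegreeFiltration

namespace WordSeries

variable {σ R : Type*} [CommRing R]

variable (σ R) in
/-- The series in which, if a letter `a` is given the degree `a`, the coefficient of each word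
`w` of positive letters is of degree less than `w.sum + j`. -/
def coeffDegreeLT (j : ℕ) : AddSubgroup (WordSeries ℕ (MvPolynomial σ R)) where
  carrier := {f | ∀ w, (∀ a ∈ w, 0 < a) → f w ∈ degreeLT σ R (w.sum + j)}
  zero_mem' w _ := (degreeLT σ R (w.sum + j)).zero_mem
  add_mem' hf hg w hw := (degreeLT σ R (w.sum + j)).add_mem (hf w hw) (hg w hw)
  neg_mem' hf w hw := (degreeLT σ R (w.sum + j)).neg_mem (hf w hw)

variable {f : WordSeries ℕ (MvPolynomial σ R)} {u v : ℕ → MvPolynomial σ R}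

theorem coeffDegreeLT_le_succ (j : ℕ) : coeffDegreeLT σ R j ≤ coeffDegreeLT σ R (j + 1) :=
  fun _ hf w hw => degreeLT_mono (Nat.le_succ _) (hf w hw)

theorem oneAddMul_sub (u : ℕ → R) (f g : WordSeries ℕ R) :
    oneAddMul u (f - g) = oneAddMul u f - oneAddMul u g := by
  funext w
  cases w with
  | nil => rfl
  | cons a w => simp only [oneAddMul, Pi.sub_apply]; ring

theorem oneAddMul_mem_coeffDegreeLT {j : ℕ} (hu : ∀ a, (u a).IsHomogeneous a)
    (hf : f ∈ coeffDegreeLT σ R j) : oneAddMul u f ∈ coeffDegreeLT σ R j := by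
  rintro (_ | ⟨a, w⟩) hw
  · exact hf [] hw
  · have h := mul_mem_degreeLT (hu a) (hf w fun b hb => hw b (List.mem_cons_of_mem a hb))
    rw [← add_assoc, ← List.sum_cons] at h
    exact add_mem (hf _ hw) h

theorem oneAddInvMul_sub_mem_coeffDegreeLT {j : ℕ} (hv : ∀ a, (v a).IsHomogeneous 0)
    (hf : f ∈ coeffDegreeLT σ R (j + 1)) : oneAddInvMul v f - f ∈ coeffDegreeLT σ R j := by
  intro w hw
  induction w with
  | nil => simp [oneAddInvMul]
  | cons a w ih =>
    rw [List.forall_mem_cons] at hw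
    have hlt : oneAddInvMul v f w ∈ degreeLT σ R (w.sum + (j + 1)) := by
      rw [← sub_add_cancel (oneAddInvMul v f w) (f w)]
      exact add_mem (degreeLT_mono (Nat.le_succ _) (ih hw.2)) (hf w hw.2)
    have hmul := mul_mem_degreeLT (hv a) hlt
    rw [Pi.sub_apply, oneAddInvMul, sub_sub_cancel_left, List.sum_cons]
    exact neg_mem (degreeLT_mono (by omega) hmul)

theorem isHomogeneous_prodOneAdd {l : List (ℕ → MvPolynomial σ R)}
    (hl : ∀ u ∈ l, ∀ a, (u a).IsHomogeneous a) (w : List ℕ) :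
    (prodOneAdd l w).IsHomogeneous w.sum := by
  induction l generalizing w with
  | nil =>
    cases w with
    | nil => exact isHomogeneous_one σ R
    | cons a w => exact isHomogeneous_zero σ R _
  | cons u l ih =>
    rw [List.forall_mem_cons] at hl
    cases w with
    | nil => exact ih hl.2 []
    | cons a w => exact (ih hl.2 _).add ((hl.1 a).mul (ih hl.2 w))

theorem prodOneAddDiv_sub_prodOneAdd_mem_coeffDegreeLT
    {l : List ((ℕ → MvPolynomial σ R) × (ℕ → MvPolynomial σ R))}
    (hl : ∀ p ∈ l, ∀ a, (p.1 a).IsHomogeneous a ∧ (p.2 a).IsHomogeneous 0) :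
    prodOneAddDiv l - prodOneAdd (l.map Prod.fst) ∈ coeffDegreeLT σ R 0 := by
  induction l with
  | nil => simp [prodOneAddDiv, prodOneAdd]
  | cons p l ih =>
    rw [List.forall_mem_cons] at hl
    obtain ⟨hp, hl⟩ := hl
    have hprod : prodOneAdd (l.map Prod.fst) ∈ coeffDegreeLT σ R 1 := fun w _ =>
      mem_degreeLT_of_isHomogeneous (isHomogeneous_prodOneAdd
        (List.forall_mem_map.mpr fun q hq a => (hl q hq a).1) w)
    have hdiv : prodOneAddDiv l ∈ coeffDegreeLT σ R 1 := by
      rw [← sub_add_cancel (prodOneAddDiv l) (prodOneAdd (l.map Prod.fst))]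
      exact add_mem (coeffDegreeLT_le_succ 0 (ih hl)) hprod
    have hinv := oneAddInvMul_sub_mem_coeffDegreeLT (fun a => (hp a).2) hdiv
    have h := oneAddMul_mem_coeffDegreeLT (fun a => (hp a).1) (add_mem hinv (ih hl))
    rwa [sub_add_sub_cancel, oneAddMul_sub] at h

end WordSeries

section MonomialQSym

variable {σ R : Type*} [CommRing R]

variable (R) in
/-- The monomial quasisymmetric polynomial `M_α` in the variables `X 0, …, X (n - 1)`. -/
def monomialQSym (n : ℕ) (α : List ℕ) : MvPolynomial (Fin n) R :=
  WordSeries.prodOneAdd (List.ofFn fun (v : Fin n) a => X v ^ a) α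

theorem isHomogeneous_monomialQSym (n : ℕ) (α : List ℕ) :
    (monomialQSym R n α).IsHomogeneous α.sum := by
  refine WordSeries.isHomogeneous_prodOneAdd (fun u hu a => ?_) α
  obtain ⟨v, rfl⟩ := List.mem_ofFn.mp hu
  simpa only [one_mul] using (isHomogeneous_X R v).pow a

end MonomialQSym

theorem vanishingPoly_sub_monomialQSym_mem_degreeLT (n : ℕ) {d : ℕ} (α : Composition d) :
    vanishingPoly n α - monomialQSym ℚ n α.blocks ∈ degreeLT (Fin n) ℚ d := by
  have h := WordSeries.prodOneAddDiv_sub_prodOneAdd_mem_coeffDegreeLT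
    (l := List.ofFn fun v : Fin n =>
      (fun a => (X v : MvPolynomial (Fin n) ℚ) ^ a, fun a => C (((v : ℕ) : ℚ) + 1) ^ a))
    (fun p hp a => by
      obtain ⟨v, rfl⟩ := List.mem_ofFn.mp hp
      exact ⟨by simpa only [one_mul] using (isHomogeneous_X ℚ v).pow a,
        by simpa only [zero_mul] using (isHomogeneous_C (Fin n) _).pow a⟩)
    α.blocks fun a ha => α.blocks_pos ha
  rw [List.map_ofFn, α.blocks_sum, Pi.sub_apply, ← vanishingPoly_eq_prodOneAddDiv] at h
  exact h

section LeadingForms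

variable {σ R : Type*} [CommRing R]

/-- Every element of `T` is a homogeneous polynomial that agrees, up to terms of smaller degree,
with an element of `J`. -/
def AreLeadingForms (T : Set (MvPolynomial σ R)) (J : Ideal (MvPolynomial σ R)) : Prop :=
  ∀ t ∈ T, ∃ d, t.IsHomogeneous d ∧ ∃ p ∈ J, p - t ∈ degreeLT σ R d

variable {T : Set (MvPolynomial σ R)} {J K : Ideal (MvPolynomial σ R)} {S : Set (σ →₀ ℕ)}

theorem AreLeadingForms.homogeneousComponent_monomial_mul_mem (hT : AreLeadingForms T J)
    {t : MvPolynomial σ R} (ht : t ∈ T) (m : σ →₀ ℕ) (c : R) (d : ℕ) :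
    homogeneousComponent d (monomial m c * t) ∈ J.restrictScalars R ⊔ degreeLT σ R d := by
  obtain ⟨e, hte, p, hp, hpt⟩ := hT t ht
  have hm : (monomial m c).IsHomogeneous m.degree := isHomogeneous_monomial c rfl
  rw [homogeneousComponent_of_mem (hm.mul hte)]
  split_ifs with hd
  · rw [hd, ← sub_sub_cancel (monomial m c * p) (monomial m c * t), ← mul_sub]
    exact sub_mem (Submodule.mem_sup_left (J.mul_mem_left _ hp))
      (Submodule.mem_sup_right (mul_mem_degreeLT hm hpt))
  · exact zero_mem _

theorem AreLeadingForms.homogeneousComponent_mem_sup (hT : AreLeadingForms T J)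
    {q : MvPolynomial σ R} (hq : q ∈ Ideal.span T) (d : ℕ) :
    homogeneousComponent d q ∈ J.restrictScalars R ⊔ degreeLT σ R d := by
  induction hq using Submodule.closure_induction with
  | zero => rw [map_zero]; exact zero_mem _
  | add x y _ _ hx hy => rw [map_add]; exact add_mem hx hy
  | smul_mem r t ht =>
    rw [smul_eq_mul]
    induction r using MvPolynomial.induction_on' with
    | monomial m c => exact hT.homogeneousComponent_monomial_mul_mem ht m c d
    | add p q hp hq => rw [add_mul, map_add]; exact add_mem hp hq

theorem homogeneousComponent_mem_restrictSupport {s : MvPolynomial σ R}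
    (hs : s ∈ restrictSupport R S) (d : ℕ) :
    homogeneousComponent d s ∈ restrictSupport R S := by
  rw [mem_restrictSupport_iff] at hs ⊢
  intro m hm
  rw [support_homogeneousComponent] at hm
  exact hs (Finset.mem_of_mem_filter m hm)

theorem AreLeadingForms.homogeneousComponent_mem_span (hT : AreLeadingForms T J)
    {q : MvPolynomial σ R} (hq : q ∈ Ideal.span T) (d : ℕ) :
    homogeneousComponent d q ∈ Ideal.span T := by
  let _ : GradedAlgebra (homogeneousSubmodule σ R) := gradedAlgebra
  exact homogeneousComponent_mem_of_mem
    (Ideal.homogeneous_span _ _ fun t ht => (hT t ht).imp fun _ h => h.1) hq d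

section SpansModulo

variable (hT : AreLeadingForms T J)
  (hS : (Ideal.span T).restrictScalars R ⊔ restrictSupport R S = ⊤)

include hT hS

theorem AreLeadingForms.exists_isHomogeneous_sub_mem {d : ℕ} {p : MvPolynomial σ R}
    (hp : p ∈ degreeLT σ R (d + 1)) :
    ∃ s ∈ restrictSupport R S, s.IsHomogeneous d ∧ homogeneousComponent d p - s ∈ Ideal.span T ∧
      p - s ∈ J.restrictScalars R ⊔ degreeLT σ R d := by
  obtain ⟨q, hq, s, hs, rfl⟩ := Submodule.mem_sup.mp (hS.symm ▸ Submodule.mem_top : p ∈ _)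
  refine ⟨homogeneousComponent d s, homogeneousComponent_mem_restrictSupport hs d,
    homogeneousComponent_isHomogeneous d s, ?_, ?_⟩
  · rw [map_add, add_sub_cancel_right]
    exact hT.homogeneousComponent_mem_span hq d
  · have hlower : _ ∈ J.restrictScalars R ⊔ degreeLT σ R d :=
      Submodule.mem_sup_right (sub_homogeneousComponent_mem_degreeLT hp)
    have h := add_mem hlower (hT.homogeneousComponent_mem_sup hq d)
    rwa [map_add, ← sub_sub, sub_right_comm _ (homogeneousComponent d q), sub_add_cancel] at h

theorem AreLeadingForms.degreeLT_le_sup (d : ℕ) :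
    degreeLT σ R d ≤ J.restrictScalars R ⊔ restrictSupport R S ⊓ degreeLT σ R d := by
  induction d with
  | zero => exact degreeLT_zero.trans_le bot_le
  | succ d ih =>
    intro p hp
    obtain ⟨s, hs, hsd, -, hps⟩ := hT.exists_isHomogeneous_sub_mem hS hp
    have hmono : J.restrictScalars R ⊔ degreeLT σ R d ≤
        J.restrictScalars R ⊔ restrictSupport R S ⊓ degreeLT σ R (d + 1) :=
      sup_le le_sup_left
        (ih.trans (sup_le_sup_left (inf_le_inf_left _ (degreeLT_mono d.le_succ)) _))
    rw [← sub_add_cancel p s]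
    exact add_mem (hmono hps)
      (Submodule.mem_sup_right ⟨hs, mem_degreeLT_of_isHomogeneous hsd⟩)

theorem AreLeadingForms.sup_restrictSupport_eq_top :
    J.restrictScalars R ⊔ restrictSupport R S = ⊤ := by
  refine eq_top_iff.mpr fun p _ => ?_
  have hp := hT.degreeLT_le_sup hS _ (mem_degreeLT_totalDegree p)
  exact (sup_le_sup_left inf_le_left (J.restrictScalars R)) hp

variable (hJK : J ≤ K) (hK : K.restrictScalars R ⊓ restrictSupport R S = ⊥)

include hJK hK

theorem AreLeadingForms.eq_of_le_of_inf_restrictSupport_eq_bot : J = K := by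
  refine Submodule.restrictScalars_injective R _ _
    (eq_of_le_of_inf_le_of_sup_le (z := restrictSupport R S) hJK ?_ ?_)
  · exact hK.trans_le bot_le
  · exact le_top.trans (hT.sup_restrictSupport_eq_top hS).ge

theorem AreLeadingForms.homogeneousComponent_mem_span_of_mem {d : ℕ} {p : MvPolynomial σ R}
    (hpK : p ∈ K) (hp : p ∈ degreeLT σ R (d + 1)) : homogeneousComponent d p ∈ Ideal.span T := by
  obtain ⟨s, hs, hsd, hspan, hps⟩ := hT.exists_isHomogeneous_sub_mem hS hp
  obtain ⟨q, hq, r, ⟨hrS, hrd⟩, hqr⟩ := Submodule.mem_sup.mp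
    (sup_le le_sup_left (hT.degreeLT_le_sup hS d) hps)
  have hrs : r + s ∈ K.restrictScalars R ⊓ restrictSupport R S := by
    refine ⟨?_, add_mem hrS hs⟩
    have hsub : r + s = p - q := by linear_combination hqr
    exact hsub ▸ sub_mem hpK (hJK hq)
  have hs0 : s = 0 := by
    rw [hK, Submodule.mem_bot, add_comm, ← eq_neg_iff_add_eq_zero] at hrs
    rw [← homogeneousComponent_eq_self hsd, hrs,
      homogeneousComponent_eq_zero_of_mem_degreeLT (neg_mem hrd)]
  rwa [hs0, sub_zero] at hspan

end SpansModulo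

end LeadingForms

theorem topComponent_eq_of_sub_mem_degreeLT {n d : ℕ} {p t : MvPolynomial (Fin n) ℚ}
    (ht : t.IsHomogeneous d) (ht0 : t ≠ 0) (h : p - t ∈ degreeLT (Fin n) ℚ d) :
    topComponent p = t := by
  have hcomp : homogeneousComponent d p = t := by
    rw [← sub_add_cancel p t, map_add, homogeneousComponent_eq_zero_of_mem_degreeLT h, zero_add,
      homogeneousComponent_eq_self ht]
  have hdeg : p.totalDegree = d := by
    refine le_antisymm (Finset.sup_le fun m hm => ?_) (not_lt.mp fun hlt => ht0 ?_)
    · have hp := add_mem (degreeLT_mono d.le_succ h) (mem_degreeLT_of_isHomogeneous ht)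
      rw [sub_add_cancel] at hp
      exact Nat.le_of_lt_succ (mem_degreeLT.mp hp m hm)
    · rw [← hcomp, homogeneousComponent_eq_zero _ _ hlt]
  rw [topComponent, hdeg, hcomp]

theorem AreLeadingForms.span_eq_topDegreeIdeal {n : ℕ} {T : Set (MvPolynomial (Fin n) ℚ)}
    {J K : Ideal (MvPolynomial (Fin n) ℚ)} {S : Set (Fin n →₀ ℕ)} (hT : AreLeadingForms T J)
    (hS : (Ideal.span T).restrictScalars ℚ ⊔ restrictSupport ℚ S = ⊤) (hJK : J ≤ K)
    (hK : K.restrictScalars ℚ ⊓ restrictSupport ℚ S = ⊥) : Ideal.span T = topDegreeIdeal K := by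
  apply le_antisymm <;> refine Ideal.span_le.mpr ?_
  · intro t ht
    obtain ⟨d, htd, p, hp, hpt⟩ := hT t ht
    obtain rfl | ht0 := eq_or_ne t 0
    · exact zero_mem _
    · exact Ideal.subset_span ⟨p, hJK hp, topComponent_eq_of_sub_mem_degreeLT htd ht0 hpt⟩
  · rintro _ ⟨p, hp, rfl⟩
    exact hT.homogeneousComponent_mem_span_of_mem hS hJK hK hp (mem_degreeLT_totalDegree p)

/-! ### Interpolation -/

section Interpolation

variable {σ k : Type*} [Field k]

/-- The values of a polynomial at the points of `P`, as a linear map. -/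
def evalAt (P : Set (σ → k)) : MvPolynomial σ k →ₗ[k] (P → k) :=
  LinearMap.pi fun x => (aeval x.1).toLinearMap

theorem ker_evalAt (P : Set (σ → k)) : (evalAt P).ker = (vanishingIdeal k P).restrictScalars k := by
  ext p
  rw [LinearMap.mem_ker, funext_iff, Subtype.forall]
  exact Iff.rfl

theorem exists_eval_eq_one_and_eval_eq_zero {x y : σ → k} (h : x ≠ y) :
    ∃ p : MvPolynomial σ k, eval x p = 1 ∧ eval y p = 0 := by
  obtain ⟨i, hi⟩ := Function.ne_iff.mp h
  exact ⟨C (x i - y i)⁻¹ * (X i - C (y i)), by simp [sub_ne_zero.mpr hi], by simp⟩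

theorem evalAt_surjective (P : Set (σ → k)) [Finite P] : Function.Surjective (evalAt P) := by
  classical
  have := Fintype.ofFinite P
  choose! p hp_one hp_zero using
    fun (x y : P) (h : x ≠ y) => exists_eval_eq_one_and_eval_eq_zero (Subtype.coe_ne_coe.mpr h)
  intro f
  refine ⟨∑ x, C (f x) * ∏ y ∈ Finset.univ.erase x, p x y, funext fun z => ?_⟩
  change eval z.1 _ = f z
  simp only [map_sum, map_mul, map_prod, eval_C]
  rw [Finset.sum_eq_single z _ (by simp)]
  · rw [Finset.prod_eq_one fun y hy => hp_one z y (Finset.ne_of_mem_erase hy).symm, mul_one]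
  · intro x _ hx
    rw [Finset.prod_eq_zero (Finset.mem_erase.mpr ⟨hx.symm, Finset.mem_univ z⟩)
      (hp_zero x z hx), mul_zero]

theorem vanishingIdeal_inf_restrictSupport_eq_bot {P : Set (σ → k)} [Finite P] {S : Set (σ →₀ ℕ)}
    {φ : S → P} (hφ : Function.Injective φ)
    (hS : (vanishingIdeal k P).restrictScalars k ⊔ restrictSupport k S = ⊤) :
    (vanishingIdeal k P).restrictScalars k ⊓ restrictSupport k S = ⊥ := by
  have := Fintype.ofFinite P
  have : Finite S := Finite.of_injective φ hφ
  let b := basisRestrictSupport k S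
  have : Module.Finite k (restrictSupport k S) := Module.Finite.of_basis b
  let f : restrictSupport k S →ₗ[k] (P → k) := (evalAt P).domRestrict (restrictSupport k S)
  have hsurj : Function.Surjective f := by
    rw [LinearMap.surjective_domRestrict_iff (evalAt_surjective P), ker_evalAt]
    exact (codisjoint_iff.mpr hS).symm
  have hcard : Module.finrank k (restrictSupport k S) ≤ Module.finrank k (P → k) := by
    rw [Module.finrank_fintype_fun_eq_card, ← Nat.card_eq_fintype_card,
      Module.finrank_eq_nat_card_basis b]
    exact Nat.card_le_card_of_injective φ hφ
  have hrank := le_antisymm hcard (LinearMap.finrank_le_finrank_of_surjective hsurj)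
  have hinj := (LinearMap.injective_iff_surjective_of_finrank_eq_finrank hrank).mpr hsurj
  rw [← ker_evalAt]
  exact (LinearMap.injective_domRestrict_iff.mp hinj).symm.eq_bot

end Interpolation

/-! ### Quasisymmetric polynomials -/

section Shape

variable {n : ℕ}

/-- The nonzero exponents of a monomial, in the order of the variables. -/
def shape (m : Fin n →₀ ℕ) : List ℕ := (m.support.sort (· ≤ ·)).map m

theorem pos_of_mem_shape {m : Fin n →₀ ℕ} {a : ℕ} (ha : a ∈ shape m) : 0 < a := by
  obtain ⟨v, hv, rfl⟩ := List.mem_map.mp ha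
  exact Nat.pos_of_ne_zero (Finsupp.mem_support_iff.mp ((Finset.mem_sort _).mp hv))

theorem shape_eq_nil_iff {m : Fin n →₀ ℕ} : shape m = [] ↔ m = 0 := by
  rw [← List.length_eq_zero_iff, shape, List.length_map, Finset.length_sort, Finset.card_eq_zero,
    Finsupp.support_eq_empty]

variable {k : ℕ} {i : Fin k → Fin n}

theorem sum_single_apply (hi : StrictMono i) (a : Fin k → ℕ) (t : Fin k) :
    (∑ s, Finsupp.single (i s) (a s)) (i t) = a t := by
  classical
  simp [Finsupp.finsetSum_apply, Finsupp.single_apply, hi.injective.eq_iff]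

theorem sort_support_sum_single (hi : StrictMono i) {a : Fin k → ℕ} (ha : ∀ t, 0 < a t) :
    (∑ t, Finsupp.single (i t) (a t)).support.sort (· ≤ ·) = List.ofFn i := by
  classical
  have hsupp : (∑ t, Finsupp.single (i t) (a t)).support = (List.ofFn i).toFinset := by
    ext v
    rw [Finsupp.mem_support_iff, List.mem_toFinset, List.mem_ofFn]
    refine ⟨fun hv => ?_, ?_⟩
    · contrapose! hv
      rw [Finsupp.finsetSum_apply]
      exact Finset.sum_eq_zero fun t _ => Finsupp.single_eq_of_ne' (hv t)
    · rintro ⟨t, rfl⟩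
      rw [sum_single_apply hi]
      exact (ha t).ne'
  rw [hsupp, List.toFinset_sort _ (List.nodup_ofFn.mpr hi.injective)]
  exact hi.monotone.sortedLE_ofFn.pairwise

theorem shape_sum_single (hi : StrictMono i) {a : Fin k → ℕ} (ha : ∀ t, 0 < a t) :
    shape (∑ t, Finsupp.single (i t) (a t)) = List.ofFn a := by
  rw [shape, sort_support_sum_single hi ha, List.map_ofFn]
  exact congrArg List.ofFn (funext (sum_single_apply hi a))

theorem exists_sum_single_eq {m : Fin n →₀ ℕ} {α : List ℕ} (h : shape m = α) :
    ∃ i : Fin α.length → Fin n, StrictMono i ∧ ∑ t, Finsupp.single (i t) (α.get t) = m := by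
  subst h
  have hcard : m.support.card = (shape m).length := by simp [shape]
  let e := m.support.orderIsoOfFin hcard
  refine ⟨fun t => e t, e.strictMono, ?_⟩
  calc ∑ t, Finsupp.single (e t : Fin n) ((shape m).get t)
      = ∑ t, Finsupp.single (e t : Fin n) (m (e t)) := by
        refine Finset.sum_congr rfl fun t _ => ?_
        rw [Finset.coe_orderIsoOfFin_apply, Finset.orderEmbOfFin_apply]
        exact congrArg (Finsupp.single _) (List.getElem_map _)
    _ = ∑ v : m.support, Finsupp.single (v : Fin n) (m v) :=
        e.toEquiv.sum_comp fun v => Finsupp.single (v : Fin n) (m v)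
    _ = m := (Finset.sum_coe_sort _ _).trans m.sum_single

end Shape

section MonomialQSym

variable {R : Type*} [CommRing R] {n : ℕ}

theorem monomialQSym_eq_sum_monomial (α : List ℕ) :
    monomialQSym R n α = ∑ i ∈ increasingMaps α.length n,
      monomial (∑ t, Finsupp.single (i t) (α.get t)) 1 := by
  conv_lhs => rw [monomialQSym, ← List.ofFn_get α, WordSeries.prodOneAdd_ofFn]
  simp only [monomial_sum_one, X_pow_eq_monomial]

theorem coeff_monomialQSym {α : List ℕ} (hα : ∀ a ∈ α, 0 < a) (m : Fin n →₀ ℕ) :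
    coeff m (monomialQSym R n α) = if shape m = α then 1 else 0 := by
  classical
  have hpos : ∀ t, 0 < α.get t := fun t => hα _ (α.get_mem t)
  rw [monomialQSym_eq_sum_monomial, coeff_sum]
  simp only [coeff_monomial]
  split_ifs with h
  · obtain ⟨i, hi, rfl⟩ := exists_sum_single_eq h
    rw [Finset.sum_eq_single_of_mem i (mem_increasingMaps.mpr hi), if_pos rfl]
    refine fun j hj hne => if_neg fun hij => hne (List.ofFn_injective ?_)
    rw [← sort_support_sum_single (mem_increasingMaps.mp hj) hpos, hij,
      sort_support_sum_single hi hpos]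
  · refine Finset.sum_eq_zero fun i hi => if_neg ?_
    rintro rfl
    rw [shape_sum_single (mem_increasingMaps.mp hi) hpos, List.ofFn_get] at h
    exact h rfl

theorem monomialQSym_eq_zero {α : List ℕ} (h : n < α.length) : monomialQSym R n α = 0 :=
  WordSeries.prodOneAdd_eq_zero _ _ (by rwa [List.length_ofFn])

variable (R n) in
/-- The monomial quasisymmetric polynomials `M_α` with `α` a nonempty composition. -/
def monomialQSymPos : Set (MvPolynomial (Fin n) R) :=
  {p | ∃ α : List ℕ, α ≠ [] ∧ (∀ a ∈ α, 0 < a) ∧ p = monomialQSym R n α}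

theorem eq_sum_C_mul_monomialQSym {f : MvPolynomial (Fin n) R} {c : List ℕ → R}
    (hc : ∀ m, coeff m f = c (shape m)) :
    f = ∑ α ∈ f.support.image shape, C (c α) * monomialQSym R n α := by
  ext m
  have hcoeff : ∀ α ∈ f.support.image shape,
      coeff m (C (c α) * monomialQSym R n α) = if shape m = α then c α else 0 := by
    intro α hα
    obtain ⟨m', -, rfl⟩ := Finset.mem_image.mp hα
    rw [coeff_C_mul, coeff_monomialQSym fun a => pos_of_mem_shape, mul_ite, mul_one, mul_zero]
  rw [coeff_sum, Finset.sum_congr rfl hcoeff, Finset.sum_ite_eq, hc]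
  refine (ite_eq_left_iff.mpr fun hm => ?_).symm
  rw [← hc]
  by_contra hne
  exact hm (Finset.mem_image_of_mem shape (mem_support_iff.mpr (Ne.symm hne)))

end MonomialQSym

theorem isQuasisymmetric_iff_factorsThrough_shape {n : ℕ} {f : MvPolynomial (Fin n) ℚ} :
    IsQuasisymmetric f ↔ Function.FactorsThrough (fun m => coeff m f) shape := by
  refine ⟨fun hf m m' h => ?_, fun hf k a ha i j hi hj => hf ?_⟩
  · obtain ⟨i, hi, hm⟩ := exists_sum_single_eq h
    obtain ⟨j, hj, hm'⟩ := exists_sum_single_eq (rfl : shape m' = shape m')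
    have hij := hf _ _ (fun t => pos_of_mem_shape (List.get_mem _ t)) i j hi hj
    rwa [hm, hm'] at hij
  · rw [shape_sum_single hi ha, shape_sum_single hj ha]

theorem span_QSymPos (n : ℕ) : Ideal.span (QSymPos n) = Ideal.span (monomialQSymPos ℚ n) := by
  apply le_antisymm <;> refine Ideal.span_le.mpr ?_
  · rintro f ⟨hf, hf0⟩
    rw [isQuasisymmetric_iff_factorsThrough_shape] at hf
    rw [eq_sum_C_mul_monomialQSym fun m => (hf.extend_apply 0 m).symm]
    refine sum_mem fun α hα => Ideal.mul_mem_left _ _ (Ideal.subset_span ?_)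
    obtain ⟨m, hm, rfl⟩ := Finset.mem_image.mp hα
    refine ⟨shape m, fun h => ?_, fun a => pos_of_mem_shape, rfl⟩
    rw [shape_eq_nil_iff.mp h] at hm
    exact mem_support_iff.mp hm hf0
  · rintro _ ⟨α, hα0, hα, rfl⟩
    refine Ideal.subset_span ⟨isQuasisymmetric_iff_factorsThrough_shape.mpr fun m m' h => ?_, ?_⟩
    · simp only [coeff_monomialQSym hα, h]
    · rw [constantCoeff_eq, coeff_monomialQSym hα, shape_eq_nil_iff.mpr rfl, if_neg hα0.symm]

/-! ### Spanning by the monomials below the diagonal -/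

section Refinements

/-- The compositions that refine a given one: the monomial quasisymmetric functions they index sum
to the fundamental one. Vanishing parts of the given list are ignored. -/
def refinements : List ℕ → List (List ℕ)
  | [] => [[]]
  | 0 :: w => refinements w
  | 1 :: w => (refinements w).map (1 :: ·)
  | (a + 2) :: w => (refinements ((a + 1) :: w)).flatMap fun γ =>
      [1 :: γ, γ.modifyHead (· + 1)]
termination_by w => (w.length, w.sum)

theorem pos_of_mem_refinements {α γ : List ℕ} (hγ : γ ∈ refinements α) : ∀ a ∈ γ, 0 < a := by
  induction α using refinements.induct generalizing γ with
  | case1 =>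
    rw [refinements, List.mem_singleton] at hγ
    exact hγ ▸ List.forall_mem_nil _
  | case2 w ih =>
    rw [refinements] at hγ
    exact ih hγ
  | case3 w ih =>
    rw [refinements] at hγ
    obtain ⟨δ, hδ, rfl⟩ := List.mem_map.mp hγ
    exact List.forall_mem_cons.mpr ⟨one_pos, ih hδ⟩
  | case4 a w ih =>
    rw [refinements] at hγ
    obtain ⟨δ, hδ, hγ⟩ := List.mem_flatMap.mp hγ
    have hpos := ih hδ
    rw [List.mem_pair] at hγ
    rcases hγ with rfl | rfl
    · exact List.forall_mem_cons.mpr ⟨one_pos, hpos⟩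
    · cases δ <;> simp_all

theorem nil_notMem_refinements (a : ℕ) (w : List ℕ) : [] ∉ refinements ((a + 1) :: w) := by
  induction a with
  | zero => simp [refinements]
  | succ a ih =>
    rw [refinements, List.mem_flatMap]
    rintro ⟨δ, hδ, h⟩
    cases δ
    · exact ih hδ
    · simp at h

end Refinements

section FundamentalQSym

variable {R : Type*} [CommRing R]

/-- The fundamental quasisymmetric function `F_α`, evaluated at a list of elements of a ring. -/
def fundamentalQSym (l : List R) (α : List ℕ) : R :=
  ((refinements α).map (WordSeries.prodOneAdd (l.map fun x a => x ^ a))).sum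

@[simp] theorem fundamentalQSym_nil (l : List R) : fundamentalQSym l [] = 1 := by
  simp [fundamentalQSym, refinements]

theorem fundamentalQSym_one_cons (x : R) (l : List R) (w : List ℕ) :
    fundamentalQSym (x :: l) (1 :: w) = x * fundamentalQSym l w + fundamentalQSym l (1 :: w) := by
  simp only [fundamentalQSym, refinements, List.map_map, ← List.sum_map_mul_left,
    ← List.sum_map_add]
  refine congrArg List.sum (List.map_congr_left fun γ _ => ?_)
  simp [WordSeries.prodOneAdd_cons_cons, add_comm]

theorem fundamentalQSym_add_two_cons (x : R) (l : List R) (a : ℕ) (w : List ℕ) :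
    fundamentalQSym (x :: l) ((a + 2) :: w)
      = x * fundamentalQSym (x :: l) ((a + 1) :: w) + fundamentalQSym l ((a + 2) :: w) := by
  simp only [fundamentalQSym, refinements, List.flatMap_def, List.map_flatten, List.sum_flatten,
    List.map_map, ← List.sum_map_mul_left, ← List.sum_map_add]
  refine congrArg List.sum (List.map_congr_left fun γ hγ => ?_)
  obtain ⟨g, γ, rfl⟩ := List.exists_cons_of_ne_nil (ne_of_mem_of_not_mem hγ
    (nil_notMem_refinements a w))
  simp only [List.map_cons, Function.comp_apply, List.modifyHead_cons,
    WordSeries.prodOneAdd_cons_cons, pow_one, List.map_nil, List.sum_cons, List.sum_nil, add_zero]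
  ring

theorem fundamentalQSym_cons (x : R) (l : List R) {b : ℕ} (hb : 0 < b) (w : List ℕ) :
    fundamentalQSym (x :: l) (b :: w) = x ^ b * fundamentalQSym l w
      + ∑ t ∈ Finset.range b, x ^ t * fundamentalQSym l ((b - t) :: w) := by
  induction b, hb using Nat.le_induction with
  | base => simp [fundamentalQSym_one_cons]
  | succ b hb ih =>
    obtain ⟨a, rfl⟩ := Nat.exists_eq_add_of_le' hb
    rw [fundamentalQSym_add_two_cons, ih, Finset.sum_range_succ' _ (a + 1), mul_add,
      Finset.mul_sum, pow_succ' x (a + 1)]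
    simp only [Nat.add_sub_add_right, pow_succ' x, pow_zero, Nat.sub_zero, one_mul, mul_assoc,
      ← add_assoc]

theorem WordSeries.prodOneAdd_pow_mem (A : Subring R) {l : List R} (hl : ∀ x ∈ l, x ∈ A)
    (w : List ℕ) : prodOneAdd (l.map fun x a => x ^ a) w ∈ A := by
  induction l generalizing w with
  | nil => cases w with
    | nil => exact A.one_mem
    | cons a w => exact A.zero_mem
  | cons x l ih =>
    obtain ⟨hx, hl⟩ := List.forall_mem_cons.mp hl
    cases w with
    | nil => rw [prodOneAdd_nil_apply]; exact A.one_mem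
    | cons a w => exact A.add_mem (ih hl _) (A.mul_mem (A.pow_mem hx a) (ih hl _))

theorem fundamentalQSym_mem (A : Subring R) {l : List R} (hl : ∀ x ∈ l, x ∈ A) (w : List ℕ) :
    fundamentalQSym l w ∈ A := by
  refine list_sum_mem fun r hr => ?_
  obtain ⟨γ, -, rfl⟩ := List.mem_map.mp hr
  exact WordSeries.prodOneAdd_pow_mem A hl γ

theorem fundamentalQSym_ofFn_X_mem_span {n : ℕ} {α : List ℕ} (h0 : α ≠ [])
    (hα : ∀ a ∈ α, 0 < a) :
    fundamentalQSym (List.ofFn X) α ∈ Ideal.span (monomialQSymPos R n) := by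
  refine list_sum_mem fun r hr => ?_
  obtain ⟨γ, hγ, rfl⟩ := List.mem_map.mp hr
  refine Ideal.subset_span ⟨γ, ?_, pos_of_mem_refinements hγ, ?_⟩
  · obtain ⟨a, w, rfl⟩ := List.exists_cons_of_ne_nil h0
    obtain ⟨b, rfl⟩ := Nat.exists_eq_add_of_le' (hα a List.mem_cons_self)
    exact ne_of_mem_of_not_mem hγ (nil_notMem_refinements b w)
  · rw [List.map_ofFn]
    rfl

/-- Solving the recursion of `F` in the first variable for the values at the remaining variables
costs one unit of the difference between size and length. -/
theorem mul_fundamentalQSym_mul_mem_of_cons {N : AddSubgroup R} {A : Subring R} {x p : R}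
    {l : List R} {k s : ℕ} (hx : x ∈ A)
    (h : ∀ α : List ℕ, (∀ a ∈ α, 0 < a) → k + α.length ≤ s + α.sum → 0 < s + α.sum →
      ∀ q ∈ A, p * fundamentalQSym (x :: l) α * q ∈ N)
    {α : List ℕ} (hα : ∀ a ∈ α, 0 < a) (hle : k + 1 + α.length ≤ s + α.sum) {q : R}
    (hq : q ∈ A) : p * fundamentalQSym l α * q ∈ N := by
  induction α generalizing q with
  | nil =>
    have hnil := h [] hα (by omega) (by omega) q hq
    rwa [fundamentalQSym_nil] at hnil ⊢
  | cons a w ih =>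
    obtain ⟨ha, hw⟩ := List.forall_mem_cons.mp hα
    have hcons := h (a :: w) hα (by omega) (by omega) q hq
    rw [List.length_cons, List.sum_cons] at hle
    obtain rfl | ⟨b, rfl⟩ : a = 1 ∨ ∃ b, a = b + 2 := by
      rcases a with _ | _ | b
      exacts [absurd ha (lt_irrefl 0), .inl rfl, .inr ⟨b, rfl⟩]
    · have htail := ih hw (by omega) (A.mul_mem hx hq)
      convert N.sub_mem hcons htail using 1
      rw [fundamentalQSym_one_cons]
      ring
    · have hpred := h ((b + 1) :: w) (List.forall_mem_cons.mpr ⟨b.succ_pos, hw⟩)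
        (by rw [List.length_cons, List.sum_cons]; omega)
        (by rw [List.sum_cons]; omega) (x * q) (A.mul_mem hx hq)
      convert N.sub_mem hcons hpred using 1
      rw [fundamentalQSym_add_two_cons]
      ring

theorem mul_pow_mul_fundamentalQSym_mul_mem {N : AddSubgroup R} {x p q : R} {l : List R} {b : ℕ}
    (hb : 0 < b) {w : List ℕ} (h : p * fundamentalQSym (x :: l) (b :: w) * q ∈ N)
    (hlt : ∀ t < b, p * x ^ t * (fundamentalQSym l ((b - t) :: w) * q) ∈ N) :
    p * x ^ b * fundamentalQSym l w * q ∈ N := by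
  convert N.sub_mem h (N.sum_mem fun t ht => hlt t (Finset.mem_range.mp ht)) using 1
  rw [fundamentalQSym_cons x l hb, mul_add, add_mul, Finset.mul_sum, Finset.sum_mul, add_sub_assoc,
    ← Finset.sum_sub_distrib, Finset.sum_eq_zero fun t _ => by ring]
  ring

end FundamentalQSym

section LexSmaller

variable {R σ : Type*} [CommRing R] [LinearOrder σ]

theorem monomial_mul_mem_of_lex_lt {N : Submodule R (MvPolynomial σ R)} {e : σ →₀ ℕ}
    (hN : ∀ δ : σ →₀ ℕ, toLex δ < toLex e → monomial δ 1 ∈ N) {v : σ} {c : ℕ} (hc : c < e v)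
    {p : MvPolynomial σ R} (hp : p ∈ supported R (Set.Ioi v)) :
    monomial (e.filter (· < v) + Finsupp.single v c) 1 * p ∈ N := by
  rw [← p.support_sum_monomial_coeff, Finset.mul_sum]
  refine N.sum_mem fun m hm => ?_
  have hm0 : ∀ u ≤ v, m u = 0 := by
    intro u hu
    by_contra hne
    have hvars : u ∈ p.vars :=
      (mem_vars_iff_mem_support u).mpr ⟨m, hm, Finsupp.mem_support_iff.mpr hne⟩
    exact hu.not_gt (mem_supported.mp hp hvars)
  rw [monomial_mul, one_mul, ← mul_one (coeff m p), ← smul_eq_mul, ← smul_monomial]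
  refine N.smul_mem _ (hN _ (Finsupp.Lex.lt_iff.mpr ⟨v, fun u hu => ?_, ?_⟩))
  · simp [hm0 u hu.le, Finsupp.filter_apply_pos (· < v) e hu, hu.ne]
  · simpa [hm0 v le_rfl] using hc

end LexSmaller

section Dyck

variable {n : ℕ}

/-- The first `k` exponents of a monomial. -/
def truncate (e : Fin n →₀ ℕ) (k : ℕ) : Fin n →₀ ℕ := e.filter fun v => (v : ℕ) < k

theorem truncate_zero (e : Fin n →₀ ℕ) : truncate e 0 = 0 :=
  Finsupp.filter_eq_zero_iff _ _ |>.mpr fun _ h => absurd h (Nat.not_lt_zero _)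

theorem truncate_succ (e : Fin n →₀ ℕ) (v : Fin n) :
    truncate e (v + 1) = truncate e v + Finsupp.single v (e v) := by
  ext u
  rcases lt_trichotomy u v with h | rfl | h
  · simp [truncate, h, h.le, h.ne]
  · simp [truncate]
  · simp [truncate, h.not_ge, h.not_gt, h.ne']

/-- The exponents below the diagonal, which correspond to Dyck paths. -/
def IsDyck (e : Fin n →₀ ℕ) : Prop := ∀ k, 1 ≤ k → k ≤ n → (truncate e k).degree < k

variable {R : Type*} [CommRing R]

theorem drop_ofFn_X_eq_cons (v : Fin n) : (List.ofFn X : List (MvPolynomial (Fin n) R)).drop v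
    = X v :: (List.ofFn X).drop (v + 1) := by
  rw [List.drop_eq_getElem_cons (by simp), List.getElem_ofFn]

theorem mem_supported_of_mem_drop_ofFn_X {k : ℕ} {x : MvPolynomial (Fin n) R}
    (hx : x ∈ (List.ofFn X).drop k) : x ∈ supported R {v : Fin n | k ≤ v} := by
  nontriviality R
  obtain ⟨i, hi, rfl⟩ := List.mem_iff_getElem.mp hx
  rw [List.getElem_drop, List.getElem_ofFn, X_mem_supported]
  exact Nat.le_add_right k i

variable {N : Submodule R (MvPolynomial (Fin n) R)}

theorem monomial_truncate_mul_fundamentalQSym_mul_mem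
    (hJ : (Ideal.span (monomialQSymPos R n)).restrictScalars R ≤ N) {e : Fin n →₀ ℕ}
    (hN : ∀ δ : Fin n →₀ ℕ, toLex δ < toLex e → monomial δ 1 ∈ N) {k : ℕ} (hk : k ≤ n)
    {α : List ℕ} (hα : ∀ a ∈ α, 0 < a) (hle : k + α.length ≤ (truncate e k).degree + α.sum)
    (hpos : 0 < (truncate e k).degree + α.sum) {q : MvPolynomial (Fin n) R}
    (hq : q ∈ supported R {v : Fin n | k ≤ v}) :
    monomial (truncate e k) 1 * fundamentalQSym ((List.ofFn X).drop k) α * q ∈ N := by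
  induction k generalizing α q with
  | zero =>
    rw [truncate_zero, map_zero, zero_add] at hpos
    have hα0 : α ≠ [] := by rintro rfl; exact hpos.ne rfl
    exact hJ (Ideal.mul_mem_right _ _
      (Ideal.mul_mem_left _ _ (fundamentalQSym_ofFn_X_mem_span hα0 hα)))
  | succ k ih =>
    obtain ⟨v, rfl⟩ : ∃ v : Fin n, (v : ℕ) = k := ⟨⟨k, hk⟩, rfl⟩
    have hsub : supported R {u : Fin n | (v : ℕ) + 1 ≤ u} ≤ supported R {u : Fin n | (v : ℕ) ≤ u} :=
      supported_mono fun u hu => Nat.le_of_succ_le hu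
    rw [drop_ofFn_X_eq_cons v] at ih
    rw [truncate_succ e v] at hle hpos ⊢
    rcases Nat.eq_zero_or_pos (e v) with h0 | hb
    · rw [h0, Finsupp.single_zero, add_zero] at hle ⊢
      exact mul_fundamentalQSym_mul_mem_of_cons (N := N.toAddSubgroup)
        (A := (supported R {u : Fin n | (v : ℕ) ≤ u}).toSubring)
        (Algebra.subset_adjoin ⟨v, le_refl v, rfl⟩)
        (fun α hα hle hpos q hq => ih (Nat.le_of_succ_le hk) hα hle hpos hq) hα hle (hsub hq)
    · rw [map_add, Finsupp.degree_single] at hle hpos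
      rw [← mul_one (1 : R), ← monomial_mul, ← X_pow_eq_monomial]
      refine mul_pow_mul_fundamentalQSym_mul_mem (N := N.toAddSubgroup) hb
        (ih (Nat.le_of_succ_le hk) (List.forall_mem_cons.mpr ⟨hb, hα⟩) ?_ ?_ (hsub hq))
        fun t ht => ?_
      · rw [List.length_cons, List.sum_cons]; omega
      · rw [List.sum_cons]; omega
      · rw [X_pow_eq_monomial, monomial_mul, one_mul]
        refine monomial_mul_mem_of_lex_lt hN ht (mul_mem ?_ hq)
        exact fundamentalQSym_mem (supported R {u : Fin n | (v : ℕ) + 1 ≤ u}).toSubring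
          (fun x hx => mem_supported_of_mem_drop_ofFn_X hx) _

theorem monomial_mem_of_not_isDyck
    (hJ : (Ideal.span (monomialQSymPos R n)).restrictScalars R ≤ N) {e : Fin n →₀ ℕ}
    (hN : ∀ δ : Fin n →₀ ℕ, toLex δ < toLex e → monomial δ 1 ∈ N) (he : ¬ IsDyck e) :
    monomial e 1 ∈ N := by
  unfold IsDyck at he
  push Not at he
  obtain ⟨k, hk1, hkn, hk⟩ := he
  have hq : (monomial (e.filter fun v : Fin n => ¬ (v : ℕ) < k) 1 : MvPolynomial (Fin n) R)
      ∈ supported R {v : Fin n | k ≤ v} := by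
    nontriviality R
    rw [mem_supported, vars_monomial one_ne_zero]
    intro v hv
    exact not_lt.mp (Finset.mem_filter.mp (Finset.mem_coe.mp hv)).2
  have hmem := monomial_truncate_mul_fundamentalQSym_mul_mem hJ hN hkn (List.forall_mem_nil _)
    (by simpa using hk)
    (by rw [List.sum_nil, add_zero]; omega) hq
  rwa [fundamentalQSym_nil, mul_one, monomial_mul, one_mul, truncate,
    Finsupp.filter_add_filter_not] at hmem

theorem span_monomialQSymPos_sup_restrictSupport_isDyck_eq_top :
    (Ideal.span (monomialQSymPos R n)).restrictScalars R ⊔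
      restrictSupport R {e : Fin n →₀ ℕ | IsDyck e} = ⊤ := by
  set N := (Ideal.span (monomialQSymPos R n)).restrictScalars R ⊔
    restrictSupport R {e : Fin n →₀ ℕ | IsDyck e}
  have hmonomial : ∀ e : Lex (Fin n →₀ ℕ), monomial (ofLex e) 1 ∈ N := by
    intro e
    induction e using WellFoundedLT.induction with
    | ind e ih =>
      by_cases he : IsDyck (ofLex e)
      · exact Submodule.mem_sup_right ((monomial_mem_restrictSupport R).mpr (Or.inl he))
      · exact monomial_mem_of_not_isDyck le_sup_left (fun δ hδ => ih (toLex δ) hδ) he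
  refine eq_top_iff.mpr fun p _ => ?_
  rw [← p.support_sum_monomial_coeff]
  refine N.sum_mem fun m _ => ?_
  rw [← mul_one (coeff m p), ← smul_eq_mul, ← smul_monomial]
  exact N.smul_mem _ (hmonomial (toLex m))

end Dyck

/-! ### Noncrossing partitions from heights -/

namespace NoncrossingPartition

variable {n : ℕ}

theorem mem_arcs_iff (L : NoncrossingPartition n) {i j : Fin n} :
    (i, j) ∈ L.arcs ↔ L.qFun j = i ∧ i < j := by
  refine ⟨fun h => ⟨L.qFun_of_mem h, L.lt_of_mem _ h⟩, ?_⟩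
  rintro ⟨rfl, hlt⟩
  by_contra hnot
  have hj : ∀ i, (i, j) ∉ L.arcs := fun i hi => hnot (by rwa [L.qFun_of_mem hi])
  exact ((L.qFun_of_not_mem hj).2 j (SimpleGraph.Reachable.refl j)).not_gt hlt

theorem arcs_eq_of_qPerm_eq {L L' : NoncrossingPartition n} (h : L.qPerm = L'.qPerm) :
    L.arcs = L'.arcs := by
  have hq : L.qFun = L'.qFun := congrArg DFunLike.coe h
  ext ⟨i, j⟩
  rw [mem_arcs_iff, mem_arcs_iff, hq]

open Classical in
/-- The noncrossing partition whose arcs join two places of equal height when all heights strictly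
between them are larger. -/
def ofHeight (h : Fin n → ℤ) : NoncrossingPartition n where
  arcs := Finset.univ.filter fun p =>
    p.1 < p.2 ∧ h p.1 = h p.2 ∧ ∀ m, p.1 < m → m < p.2 → h p.2 < h m
  lt_of_mem p hp := (Finset.mem_filter.mp hp).2.1
  noncrossing := by
    rintro ⟨i, k⟩ hik ⟨j, l⟩ hjl hne ⟨hij, hjk, hkl⟩
    obtain ⟨-, -, hik, hinik⟩ := Finset.mem_filter.mp hik
    obtain ⟨-, -, hjl, hinjl⟩ := Finset.mem_filter.mp hjl
    dsimp only at *
    rcases hij.lt_or_eq with hij | rfl <;> rcases hkl.lt_or_eq with hkl | rfl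
    · linarith [hinik j hij hjk, hinjl k hjk hkl]
    · linarith [hinik j hij hjk]
    · linarith [hinjl k hjk hkl]
    · exact hne rfl

theorem mem_ofHeight {h : Fin n → ℤ} {i j : Fin n} : (i, j) ∈ (ofHeight h).arcs ↔
    i < j ∧ h i = h j ∧ ∀ m, i < m → m < j → h j < h m := by
  simp [ofHeight]

theorem exists_mem_ofHeight {h : Fin n → ℤ} {i₀ j : Fin n}
    (hstep : ∀ a b : Fin n, (b : ℕ) = a + 1 → h b ≤ h a + 1)
    (hj : ∀ a : Fin n, (j : ℕ) = a + 1 → h j ≤ h a) (hlt : i₀ < j) (hle : h i₀ ≤ h j) :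
    ∃ i, (i, j) ∈ (ofHeight h).arcs := by
  obtain ⟨i, ⟨hij, hi⟩, hmax⟩ :=
    (Set.toFinite {i | i < j ∧ h i ≤ h j}).exists_maximalFor id _ ⟨i₀, hlt, hle⟩
  have hbetween : ∀ m, i < m → m < j → h j < h m := fun m him hmj =>
    not_le.mp fun hm => him.not_ge (hmax ⟨hmj, hm⟩ him.le)
  refine ⟨i, mem_ofHeight.mpr ⟨hij, hi.antisymm ?_, hbetween⟩⟩
  obtain heq | hlt : (j : ℕ) = i + 1 ∨ (i : ℕ) + 1 < j := by omega
  · exact hj i heq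
  · have hsucc := hbetween ⟨i + 1, by omega⟩ (Nat.lt_succ_self i) hlt
    linarith [hstep i ⟨i + 1, by omega⟩ rfl]

end NoncrossingPartition

section DyckPartition

variable {n : ℕ}

/-- The height after `k` blocks of the lattice path whose block at `j` is an up step followed by
`e j` down steps. -/
def dyckHeight (e : Fin n →₀ ℕ) (k : ℕ) : ℤ := k - (truncate e k).degree

theorem dyckHeight_zero (e : Fin n →₀ ℕ) : dyckHeight e 0 = 0 := by
  rw [dyckHeight, truncate_zero, map_zero, Nat.cast_zero, sub_zero]

theorem dyckHeight_succ (e : Fin n →₀ ℕ) (j : Fin n) :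
    dyckHeight e (j + 1) = dyckHeight e j + 1 - e j := by
  rw [dyckHeight, dyckHeight, truncate_succ, map_add, Finsupp.degree_single]
  push_cast
  ring

/-- The noncrossing partition of the lattice path of an exponent vector. -/
def dyckPartition (e : Fin n →₀ ℕ) : NoncrossingPartition n :=
  .ofHeight fun j => dyckHeight e (j + 1)

theorem IsDyck.dyckHeight_pos {e : Fin n →₀ ℕ} (he : IsDyck e) (j : Fin n) :
    0 < dyckHeight e (j + 1) :=
  sub_pos.mpr (Nat.cast_lt.mpr (he (j + 1) (Nat.le_add_left 1 j) j.2))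

theorem IsDyck.exists_mem_dyckPartition {e : Fin n →₀ ℕ} (he : IsDyck e) {j : Fin n}
    (hj : e j ≠ 0) : ∃ i, (i, j) ∈ (dyckPartition e).arcs := by
  have hpos := he.dyckHeight_pos j
  have hj0 : 0 < (j : ℕ) := by
    by_contra h
    rw [dyckHeight_succ, Nat.eq_zero_of_not_pos h, dyckHeight_zero] at hpos
    omega
  refine NoncrossingPartition.exists_mem_ofHeight (i₀ := ⟨0, hj0.trans j.2⟩)
    (fun a b hab => ?_) (fun a ha => ?_) hj0 ?_
  · rw [dyckHeight_succ, hab]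
    omega
  · rw [dyckHeight_succ, ha]
    omega
  · rw [dyckHeight_succ, dyckHeight_zero]
    omega

theorem IsDyck.dyckHeight_eq_of_arcs_eq {e e' : Fin n →₀ ℕ} (he : IsDyck e) (he' : IsDyck e')
    (h : (dyckPartition e).arcs = (dyckPartition e').arcs) {k : ℕ} (hk : k ≤ n) :
    dyckHeight e k = dyckHeight e' k := by
  induction k using Nat.strong_induction_on with
  | _ k ih =>
    rcases k with _ | k
    · rw [dyckHeight_zero, dyckHeight_zero]
    obtain ⟨j, rfl⟩ : ∃ j : Fin n, (j : ℕ) = k := ⟨⟨k, hk⟩, rfl⟩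
    by_cases hex : ∃ i, (i, j) ∈ (dyckPartition e).arcs
    · obtain ⟨i, hi⟩ := hex
      obtain ⟨hij, heq, -⟩ := NoncrossingPartition.mem_ofHeight.mp hi
      obtain ⟨-, heq', -⟩ := NoncrossingPartition.mem_ofHeight.mp (h ▸ hi)
      rw [← heq, ← heq', ih (i + 1) (Nat.succ_lt_succ hij) i.2]
    · have hej : e j = 0 := not_not.mp fun hne => hex (he.exists_mem_dyckPartition hne)
      have hej' : e' j = 0 := not_not.mp fun hne =>
        hex (h ▸ he'.exists_mem_dyckPartition hne)
      rw [dyckHeight_succ, dyckHeight_succ, hej, hej', ih j (Nat.lt_succ_self _) j.2.le]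

theorem IsDyck.eq_of_arcs_eq {e e' : Fin n →₀ ℕ} (he : IsDyck e) (he' : IsDyck e')
    (h : (dyckPartition e).arcs = (dyckPartition e').arcs) : e = e' := by
  ext j
  have hsucc := he.dyckHeight_eq_of_arcs_eq he' h (k := j + 1) j.2
  rw [dyckHeight_succ, dyckHeight_succ, he.dyckHeight_eq_of_arcs_eq he' h j.2.le] at hsucc
  omega

theorem permPoint_injective : Function.Injective (permPoint (n := n)) := by
  intro σ τ h
  ext j
  simpa [permPoint] using congrFun h j

/-- The point of `QSV_n` attached to an exponent vector below the diagonal. -/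
def dyckPoint (e : {e : Fin n →₀ ℕ | IsDyck e}) : QSVPoints n :=
  ⟨permPoint (dyckPartition e.1).qPerm, Set.mem_image_of_mem _ ⟨_, rfl⟩⟩

theorem dyckPoint_injective : Function.Injective (dyckPoint (n := n)) := fun e e' h =>
  Subtype.ext (e.2.eq_of_arcs_eq e'.2 (NoncrossingPartition.arcs_eq_of_qPerm_eq
    (permPoint_injective (congrArg Subtype.val h))))

end DyckPartition

/-! ### The ideal of `QSV_n` -/

/-- The generators `P_α` of the ideal of `QSV_n`. -/
def vanishingPolys (n : ℕ) : Set (MvPolynomial (Fin n) ℚ) :=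
  {p | ∃ (d : ℕ) (α : Composition d), 0 < d ∧ α.length ≤ n ∧ p = vanishingPoly n α}

theorem span_vanishingPolys_le (n : ℕ) :
    Ideal.span (vanishingPolys n) ≤ vanishingIdeal ℚ (QSVPoints n) := by
  refine Ideal.span_le.mpr ?_
  rintro _ ⟨d, α, hd, -, rfl⟩
  exact vanishingPoly_mem_vanishingIdeal n α hd

theorem areLeadingForms_monomialQSymPos (n : ℕ) :
    AreLeadingForms (monomialQSymPos ℚ n) (Ideal.span (vanishingPolys n)) := by
  rintro _ ⟨α, h0, hα, rfl⟩
  refine ⟨α.sum, isHomogeneous_monomialQSym n α, ?_⟩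
  rcases le_or_gt α.length n with hlen | hlen
  · let c : Composition α.sum := ⟨α, hα _, rfl⟩
    exact ⟨vanishingPoly n c, Ideal.subset_span ⟨_, c, List.sum_pos α hα h0, hlen, rfl⟩,
      vanishingPoly_sub_monomialQSym_mem_degreeLT n c⟩
  · refine ⟨0, zero_mem _, ?_⟩
    rw [monomialQSym_eq_zero hlen, sub_zero]
    exact zero_mem _

theorem vanishingIdeal_QSVPoints_inf_restrictSupport_isDyck_eq_bot (n : ℕ) :
    (vanishingIdeal ℚ (QSVPoints n)).restrictScalars ℚ ⊓
      restrictSupport ℚ {e : Fin n →₀ ℕ | IsDyck e} = ⊥ := by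
  have : Finite (QSVPoints n) := ((Set.toFinite (QSV n)).image _).to_subtype
  refine vanishingIdeal_inf_restrictSupport_eq_bot dyckPoint_injective (top_le_iff.mp ?_)
  rw [← (areLeadingForms_monomialQSymPos n).sup_restrictSupport_eq_top
    span_monomialQSymPos_sup_restrictSupport_isDyck_eq_top]
  exact sup_le_sup_right (fun p hp => span_vanishingPolys_le n hp) _

end

theorem mainTheorem4 (n : ℕ) :
    Ideal.span {p : MvPolynomial (Fin n) ℚ |
        ∃ (d : ℕ) (α : Composition d), 0 < d ∧ α.length ≤ n ∧ p = vanishingPoly n α}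
      = MvPolynomial.vanishingIdeal ℚ (QSVPoints n) ∧
    Ideal.span (QSymPos n) = topDegreeIdeal (MvPolynomial.vanishingIdeal ℚ (QSVPoints n)) := by
  have hlead := areLeadingForms_monomialQSymPos n
  have hspan := span_monomialQSymPos_sup_restrictSupport_isDyck_eq_top (R := ℚ) (n := n)
  have hle := span_vanishingPolys_le n
  have hindep := vanishingIdeal_QSVPoints_inf_restrictSupport_isDyck_eq_bot n
  refine ⟨hlead.eq_of_le_of_inf_restrictSupport_eq_bot hspan hle hindep, ?_⟩
  rw [span_QSymPos]
  exact hlead.span_eq_topDegreeIdeal hspan hle hindep
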